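/- **Setting.** Let $n\ge 1$. A multiresolution approximation of $L^2(\mathbb{R}^n)$ (complex-valued functions) is an increasing sequence of closed subspaces $(V_j)_{j\in\mathbb{Z}}$ with $\bigcap_j V_j=\{0\}$, $\overline{\bigcup_j V_j}=L^2(\mathbb{R}^n)$, $f(\mathbf{x})\in V_j\Leftrightarrow f(2\mathbf{x})\in V_{j+1}$ and $f(\mathbf{x})\in V_0\Leftrightarrow f(\mathbf{x}-\mathbf{k})\in V_0$ for $\mathbf{k}\in\mathbb{Z}^n$, together with a scaling function $\phi\in V_0$ with $\int\phi=1$ such that, for every $j$, the functions $\phi_{(j,\mathbf{k})}(\mathbf{x})=2^{nj/2}\phi(2^j\mathbf{x}-\mathbf{k})$, $\mathbf{k}\in\mathbb{Z}^n$, form an orthonormal Hilbert basis of $V_j$. Let $W_j$ be the orthogonal complement of $V_j$ in $V_{j+1}$. An orthonormal wavelet system $(\phi,\psi)$ consists of such data and functions $\psi_\epsilon\in W_0$, $\epsilon\in\alpha$ ($\alpha$ finite), with $\int\psi_\epsilon=0$, such that for every $j$ the functions $\psi_{(\epsilon,(j,\mathbf{k}))}(\mathbf{x})=2^{nj/2}\psi_\epsilon(2^j\mathbf{x}-\mathbf{k})$,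 $\epsilon\in\alpha$, $\mathbf{k}\in\mathbb{Z}^n$, form an orthonormal Hilbert basis of $W_j$. It is compactly supported if $\phi$ and all $\psi_\epsilon$ are, and of regularity $r$ if $\phi$ and all $\psi_\epsilon$ are continuously differentiable up to order $r$ and these functions and all their derivatives up to order $r$ decay faster than the reciprocal of any polynomial. For a compact set $K\subseteq\mathbb{R}^n$ let $\mathcal{P}_{\mathrm{ab2}}(K)$ be the set of Borel probability measures $\mu$ carried by $K$ of the form $d\mu=p_\mu(\mathbf{x})\,d\mathbf{x}$ with $p_\mu\in L^2(\mathbb{R}^n)$. For $0<s<1$ put $W_s(\mu,\nu)=\inf_\gamma\int|\mathbf{x}-\mathbf{y}|^s\,d\gamma(\mathbf{x},\mathbf{y})$, the infimum being over all couplings $\gamma$ of $\mu$ and $\nu$, and for $j_0\in\mathbb{Z}$ put $$(W_{\mathrm{wav}}^{(\psi,j_0)})_s(\mu,\nu)=\sum_{\epsilon\in\alpha,\ j\ge j_0,\ \mathbf{k}\in\mathbb{Z}^n}2^{-j(s+\frac n2)}\left|\int_{\mathbb{R}^n}(p_\mu-p_\nu)(\mathbf{x})\,\overline{\psi_{(\epsilon,(j,\mathbf{k}))}(\mathbf{x})}\,d\mathbf{x}\right|.$$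 **Constants.** Below, $\sigma=(\sigma_{\mathbf{k}})_{\mathbf{k}\in\mathbb{Z}^n}$ ranges over all families of signs $\sigma_{\mathbf{k}}\in\{+1,-1\}$, and $S_\sigma(\mathbf{x})=\sum_{\mathbf{k}\in\mathbb{Z}^n,\epsilon\in\alpha}\sigma_{\mathbf{k}}\psi_{(\epsilon,(0,\mathbf{k}))}(\mathbf{x})$. Let $$a_{14}(\psi,s)=\Big(\max_{\epsilon\in\alpha}\ \sup\Big\{\Big|\int_{\mathbb{R}^n} f\psi_\epsilon\,d\mathbf{x}\Big|:\ f:\mathbb{R}^n\to\mathbb{C},\ |f(\mathbf{x})-f(\mathbf{y})|\le|\mathbf{x}-\mathbf{y}|^s\ \text{for all }\mathbf{x},\mathbf{y}\Big\}\Big)^{-1}$$ (the reciprocal of the maximal norm of $\psi_\epsilon$ in the dual of the homogeneous $s$-Hölder space), $$a_{22}(\psi,s)=\frac{\sum_{i=1}^n\sup_{\mathbf{x},\sigma}\Big|\sum_{\mathbf{k}\in\mathbb{Z}^n,\epsilon\in\alpha}\sigma_{\mathbf{k}}\frac{\partial\psi_{(\epsilon,(0,\mathbf{k}))}}{\partial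 x_i}(\mathbf{x})\Big|}{2^{1-s}(2^{1-s}-1)}+\frac{2\sup_{\mathbf{x},\sigma}|S_\sigma(\mathbf{x})|}{1-2^{-s}},\qquad a_{23}(\psi,s)=\sup_{\mathbf{x}\ne\mathbf{y},\ \sigma}\frac{|S_\sigma(\mathbf{x})-S_\sigma(\mathbf{y})|}{|\mathbf{x}-\mathbf{y}|^s},$$ and let $\tilde E_{\psi,s,j_0}=a_{22}(\psi,s)+|j_0|\,a_{23}(\psi,s)$ if $j_0<0$ and $\tilde E_{\psi,s,j_0}=a_{22}(\psi,s)$ if $j_0\ge0$. **Theorem 3.13 (New wavelet $s$-Wasserstein distance for $0<s<1$).** Fix a compact set $K\subseteq\mathbb{R}^n$, $0<s<1$, and a compactly supported orthonormal wavelet system $(\phi,\psi)$ of regularity $r\ge1$. Then for every $\eta>0$ there is an integer $J$, depending only on $\eta$, $K$, $s$ and $(\phi,\psi)$, such that for every integer $j_0\le J$ and all $\mu,\nu\in\mathcal{P}_{\mathrm{ab2}}(K)$ the series defining $(W_{\mathrm{wav}}^{(\psi,j_0)})_s(\mu,\nu)$ converges and $$a_{14}(\psi,s)\,W_s(\mu,\nu)-\eta\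 \le\ (W_{\mathrm{wav}}^{(\psi,j_0)})_s(\mu,\nu)\ \le\ \tilde E_{\psi,s,j_0}\,W_s(\mu,\nu).$$ -/

import Mathlib

open MeasureTheory
open scoped ENNReal ComplexConjugate

noncomputable section

namespace WaveletWasserstein

/-- Euclidean space `ℝⁿ`. -/
abbrev Rn (n : ℕ) : Type := EuclideanSpace ℝ (Fin n)

/-- The Hilbert space `L²(ℝⁿ)` of complex-valued functions. -/
abbrev L2 (n : ℕ) : Type := Lp ℂ 2 (volume : Measure (Rn n))

/-- A point of the lattice `ℤⁿ`, seen in `ℝⁿ`. -/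
def latticePt {n : ℕ} (k : Fin n → ℤ) : Rn n := WithLp.toLp 2 (fun i => (k i : ℝ))

/-- The dilated and translated function `f_{(j,k)}(x) = 2^{nj/2} f(2^j x - k)`. -/
def dyadic {n : ℕ} (f : Rn n → ℂ) (j : ℤ) (k : Fin n → ℤ) (x : Rn n) : ℂ :=
  (((2 : ℝ) ^ ((n : ℝ) * (j : ℝ) / 2) : ℝ) : ℂ) * f ((2 : ℝ) ^ j • x - latticePt k)

theorem memLp_dyadic {n : ℕ} {f : Rn n → ℂ} (hf : MemLp f 2 volume) (j : ℤ) (k : Fin n → ℤ) :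
    MemLp (dyadic f j k) 2 volume := by
  have h2 : ((2 : ℝ) ^ j) ≠ 0 := zpow_ne_zero _ two_ne_zero
  have h1 : MemLp (fun x => f (x - latticePt k)) 2 volume :=
    hf.comp_measurePreserving (measurePreserving_sub_right volume (latticePt k))
  have hemb : MeasurableEmbedding (fun x : Rn n => (2 : ℝ) ^ j • x) :=
    (Homeomorph.smulOfNeZero ((2 : ℝ) ^ j) h2).measurableEmbedding
  have h3 : MemLp (fun x => f (x - latticePt k)) 2
      (Measure.map (fun x : Rn n => (2 : ℝ) ^ j • x) volume) := by
    rw [Measure.map_addHaar_smul volume h2]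
    exact h1.smul_measure ENNReal.ofReal_ne_top
  have h4 := (hemb.memLp_map_measure_iff).1 h3
  exact h4.const_mul _

/-- An orthonormal wavelet system on `ℝⁿ`: a multiresolution approximation `V_j` of `L²(ℝⁿ)` with a
scaling function `φ`, and finitely many wavelet functions `ψ_ε` (`ε ∈ α`) whose dilates and
translates are orthonormal Hilbert bases of the detail spaces `W_j = V_{j+1} ⊖ V_j`. -/
structure OrthonormalWaveletSystem (n : ℕ) (α : Type*) [Fintype α] where
  /-- The approximation spaces. -/
  V : ℤ → Submodule ℂ (L2 n)
  isClosed_V : ∀ j, IsClosed (V j : Set (L2 n))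
  monotone_V : Monotone V
  iInf_V : ⨅ j, V j = ⊥
  dense_V : (⨆ j, V j).topologicalClosure = ⊤
  /-- `f(x) ∈ V_j` if and only if `f(2x) ∈ V_{j+1}`. -/
  dilation_V : ∀ (j : ℤ) (f g : L2 n), (∀ᵐ x, g x = f ((2 : ℝ) • x)) → (f ∈ V j ↔ g ∈ V (j + 1))
  /-- `f(x) ∈ V_0` if and only if `f(x - k) ∈ V_0`. -/
  translation_V : ∀ (k : Fin n → ℤ) (f g : L2 n), (∀ᵐ x, g x = f (x - latticePt k)) →
    (f ∈ V 0 ↔ g ∈ V 0)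
  /-- The scaling function. -/
  φ : Rn n → ℂ
  memLp_φ : MemLp φ 2 volume
  integrable_φ : Integrable φ volume
  integral_φ : ∫ x, φ x = 1
  orthonormal_φ : ∀ j : ℤ,
    Orthonormal ℂ (fun k : Fin n → ℤ => (memLp_dyadic memLp_φ j k).toLp (dyadic φ j k))
  span_φ : ∀ j : ℤ, (Submodule.span ℂ (Set.range
    (fun k : Fin n → ℤ => (memLp_dyadic memLp_φ j k).toLp (dyadic φ j k)))).topologicalClosure = V j
  /-- The wavelet functions. -/
  ψ : α → Rn n → ℂ
  memLp_ψ : ∀ ε, MemLp (ψ ε) 2 volume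
  integrable_ψ : ∀ ε, Integrable (ψ ε) volume
  integral_ψ : ∀ ε, ∫ x, ψ ε x = 0
  orthonormal_ψ : ∀ j : ℤ, Orthonormal ℂ (fun i : α × (Fin n → ℤ) =>
    (memLp_dyadic (memLp_ψ i.1) j i.2).toLp (dyadic (ψ i.1) j i.2))
  span_ψ : ∀ j : ℤ, (Submodule.span ℂ (Set.range (fun i : α × (Fin n → ℤ) =>
    (memLp_dyadic (memLp_ψ i.1) j i.2).toLp (dyadic (ψ i.1) j i.2)))).topologicalClosure
      = (V j)ᗮ ⊓ V (j + 1)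

/-- `f` is continuously differentiable up to order `r`, and `f` and its derivatives up to order `r`
decay faster than the reciprocal of any polynomial. -/
def IsRegularFun {n : ℕ} (r : ℕ) (f : Rn n → ℂ) : Prop :=
  ContDiff ℝ r f ∧
    ∀ m ≤ r, ∀ N : ℕ, ∃ C : ℝ, ∀ x : Rn n, ‖x‖ ^ N * ‖iteratedFDeriv ℝ m f x‖ ≤ C

section Constants

variable {n : ℕ} {α : Type*} [Fintype α]

/-- The system is of regularity `r`. -/
def OrthonormalWaveletSystem.IsRegular (S : OrthonormalWaveletSystem n α) (r : ℕ) : Prop :=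
  IsRegularFun r S.φ ∧ ∀ ε, IsRegularFun r (S.ψ ε)

/-- The scaling function and all wavelet functions have compact support. -/
def OrthonormalWaveletSystem.IsCompactlySupported (S : OrthonormalWaveletSystem n α) : Prop :=
  HasCompactSupport S.φ ∧ ∀ ε, HasCompactSupport (S.ψ ε)

/-- `f : ℝⁿ → ℂ` has `s`-Hölder seminorm at most `H`. -/
def IsHolder (s H : ℝ) (f : Rn n → ℂ) : Prop :=
  ∀ x y, ‖f x - f y‖ ≤ H * ‖x - y‖ ^ s

/-- The norm of the functional `f ↦ ∫ f g` on the homogeneous `s`-Hölder space of `ℝⁿ`, that is, the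
supremum of its modulus over the functions of `s`-Hölder seminorm at most one. (For `g` of integral
zero the functional does not see additive constants.) -/
def holderDualNorm (s : ℝ) (g : Rn n → ℂ) : ℝ :=
  sSup {c : ℝ | ∃ f : Rn n → ℂ, IsHolder s 1 f ∧ c = ‖∫ x, f x * g x‖}

/-- `η` is a choice of signs, one for each point of `ℤⁿ`. -/
def IsSign (η : (Fin n → ℤ) → ℝ) : Prop := ∀ k, η k = 1 ∨ η k = -1

/-- The signed sum `∑_{k, ε} η_k ψ_{(ε,(0,k))}(x)`. -/
def signedSum (ψ : α → Rn n → ℂ) (η : (Fin n → ℤ) → ℝ) (x : Rn n) : ℂ :=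
  ∑' k : Fin n → ℤ, ∑ ε, (η k : ℂ) * dyadic (ψ ε) 0 k x

/-- The signed sum `∑_{k, ε} η_k ∂ψ_{(ε,(0,k))}/∂x_i (x)`. -/
def signedSumDeriv (ψ : α → Rn n → ℂ) (i : Fin n) (η : (Fin n → ℤ) → ℝ) (x : Rn n) : ℂ :=
  ∑' k : Fin n → ℤ, ∑ ε,
    (η k : ℂ) * fderiv ℝ (dyadic (ψ ε) 0 k) x (EuclideanSpace.single i (1 : ℝ))

/-- `‖∑ψ‖_∞`. -/
def supSum (ψ : α → Rn n → ℂ) : ℝ :=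
  sSup {c : ℝ | ∃ x η, IsSign η ∧ c = ‖signedSum ψ η x‖}

/-- `‖∑ψ^{(i)}‖_∞`. -/
def supSumDeriv (ψ : α → Rn n → ℂ) (i : Fin n) : ℝ :=
  sSup {c : ℝ | ∃ x η, IsSign η ∧ c = ‖signedSumDeriv ψ i η x‖}

/-- `a₁₄(ψ,s) = 1 / max_ε ‖ψ_ε‖`, with the norm dual to the homogeneous Hölder space. -/
def a14 (ψ : α → Rn n → ℂ) (s : ℝ) : ℝ := 1 / ⨆ ε, holderDualNorm s (ψ ε)

/-- `a₂₂(ψ,s)`. -/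
def a22 (ψ : α → Rn n → ℂ) (s : ℝ) : ℝ :=
  (∑ i, supSumDeriv ψ i) / ((2 : ℝ) ^ (1 - s) * ((2 : ℝ) ^ (1 - s) - 1))
    + 2 * supSum ψ / (1 - (2 : ℝ) ^ (-s))

/-- `a₂₃(ψ,s) = ‖∑ψ^s‖_∞`. -/
def a23 (ψ : α → Rn n → ℂ) (s : ℝ) : ℝ :=
  sSup {c : ℝ | ∃ x y η, x ≠ y ∧ IsSign η ∧
    c = ‖signedSum ψ η x - signedSum ψ η y‖ / ‖x - y‖ ^ s}

/-- The upper constant: `a₂₂ + |j₀| a₂₃` if `j₀ < 0`, and `a₂₂` otherwise. -/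
def upperConst (ψ : α → Rn n → ℂ) (s : ℝ) (j₀ : ℤ) : ℝ :=
  if j₀ < 0 then a22 ψ s + |(j₀ : ℝ)| * a23 ψ s else a22 ψ s

end Constants

section Distances

variable {n : ℕ} {α : Type*} [Fintype α]

/-- The density `p_μ` of `μ` with respect to Lebesgue measure. -/
def density (μ : Measure (Rn n)) (x : Rn n) : ℝ := (μ.rnDeriv volume x).toReal

/-- `μ` is a probability measure carried by `K`, absolutely continuous with respect to Lebesgue
measure with a square-integrable density. -/
structure IsAb2On (K : Set (Rn n)) (μ : Measure (Rn n)) : Prop where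
  isProbabilityMeasure : IsProbabilityMeasure μ
  measure_compl : μ Kᶜ = 0
  absolutelyContinuous : μ ≪ volume
  memLp_density : MemLp (density μ) 2 volume

/-- The transport plans from `μ` to `ν`. -/
def transportPlans (μ ν : Measure (Rn n)) : Set (Measure (Rn n × Rn n)) :=
  {γ | γ.map Prod.fst = μ ∧ γ.map Prod.snd = ν}

/-- The `s`-Wasserstein distance for `0 < s ≤ 1` (no exponent `1/s`). -/
def wassersteinDist (s : ℝ) (μ ν : Measure (Rn n)) : ℝ :=
  (⨅ γ ∈ transportPlans μ ν, ∫⁻ z, ENNReal.ofReal (‖z.1 - z.2‖ ^ s) ∂γ).toReal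

/-- The detail coefficient `∫ f(x) conj(ψ_{(ε,(j,k))}(x)) dx`. -/
def detailCoeff (ψ : α → Rn n → ℂ) (f : Rn n → ℂ) (ε : α) (j : ℤ) (k : Fin n → ℤ) : ℂ :=
  ∫ x, f x * conj (dyadic (ψ ε) j k x)

/-- The summand `2^{-j(s+n/2)} |(p_μ - p_ν)^{(d)}_{(ε,(j,k))}|`, for `ε ∈ α`, `j ≥ j₀`, `k ∈ ℤⁿ`. -/
def waveletTerm (ψ : α → Rn n → ℂ) (s : ℝ) (j₀ : ℤ) (μ ν : Measure (Rn n))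
    (i : α × {j : ℤ // j₀ ≤ j} × (Fin n → ℤ)) : ℝ :=
  (2 : ℝ) ^ (-((i.2.1 : ℤ) : ℝ) * (s + (n : ℝ) / 2)) *
    ‖detailCoeff ψ (fun x => ((density μ x - density ν x : ℝ) : ℂ)) i.1 i.2.1 i.2.2‖

/-- The wavelet `s`-Wasserstein distance with lowest level `j₀`. -/
def waveletDist (ψ : α → Rn n → ℂ) (s : ℝ) (j₀ : ℤ) (μ ν : Measure (Rn n)) : ℝ :=
  ∑' i, waveletTerm ψ s j₀ μ ν i

end Distances

end WaveletWasserstein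

end

/-!
The wavelet distance and the Wasserstein distance are compared through Hölder functions.

Upper bound. For a coupling `γ` of `μ` and `ν`, each wavelet coefficient of `μ - ν` is the integral
of `ψ_i(x) - ψ_i(y)` (conjugated) against `γ`. At each point only boundedly many translates of a
compactly supported function are nonzero, so the weighted sum of `|ψ_i(x) - ψ_i(y)|` over all
positions and all scales is at most `C ∑_j 2^{-js} min(1, 2^j |x - y|)`, and hence at most
`C' |x - y|^s`, with two geometric series on the two sides of the scale `1 / |x - y|`
(`exists_sum_dyadic_sub_le`). Thus `exists_sum_waveletTerm_le`: the wavelet distance converges and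
is at most `C'` times the Wasserstein distance, with `C'` independent of the lowest level `j₀`.
The constant `a₂₂ + |j₀| a₂₃` exceeds `C'` as soon as `j₀` is low enough, because `a₂₃ > 0`: the
set defining it is bounded, and flipping a single sign changes the signed sum by `2 ∑_ε ψ_ε`, which
is not constant (`exists_le_upperConst`). Only such levels matter, since the lower bound needs
`j₀` to be low as well.

Lower bound. By Kantorovich duality (`wassersteinDist_le_of_forall_holder`, from the Hahn–Banach and
Riesz–Markov–Kakutani theorems) it suffices to bound `∫ f dμ - ∫ f dν` for a real function `f` of
`s`-Hölder seminorm `1` with `f(0) = 0`. The density `p = p_μ - p_ν` is the limit in `L²` of its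
projections to the `V_j`. Consecutive projections differ by a finite combination of wavelets, and
`|∫ f ψ_{(ε,(j,k))}|` is at most `2^{-j(s+n/2)}` times the dual Hölder norm `‖ψ_ε‖`, so the details
at the levels `j ≥ j₀` contribute at most `max_ε ‖ψ_ε‖` times the wavelet distance
(`integral_sub_integral_le`). The projection to `V_{j₀}` contributes `O(2^{j₀(1-s)})` uniformly in
`μ`, `ν` and `f`, since `∫ p = 0` and the scaling functions at level `j₀` oscillate little on `K`
(`exists_norm_sum_detailCoeff_φ_le`).
-/

noncomputable section

namespace WaveletWasserstein

/-! ### Lattice points, sums of translates, and sums over dyadic scales -/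

section Lattice

variable {n : ℕ}

lemma latticePt_sub (k l : Fin n → ℤ) : latticePt (k - l) = latticePt k - latticePt l := by
  ext i; simp [latticePt]

lemma latticePt_zero : latticePt (0 : Fin n → ℤ) = 0 := by
  ext i; simp [latticePt]

lemma finite_latticePt_norm_le (ρ : ℝ) : {k : Fin n → ℤ | ‖latticePt k‖ ≤ ρ}.Finite := by
  refine (Set.finite_Icc (fun _ : Fin n => -⌈ρ⌉) (fun _ => ⌈ρ⌉)).subset fun k hk => ?_
  have h : ∀ i, |k i| ≤ ⌈ρ⌉ := fun i => by
    have h1 : ‖(latticePt k) i‖ ≤ ‖latticePt k‖ := PiLp.norm_apply_le _ _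
    have h2 : |(k i : ℝ)| ≤ ⌈ρ⌉ := (h1.trans hk).trans (Int.le_ceil ρ)
    exact_mod_cast h2
  exact ⟨fun i => (abs_le.1 (h i)).1, fun i => (abs_le.1 (h i)).2⟩

/-- The finite set of lattice points in the ball of radius `ρ` about the origin. -/
def latticeBall (n : ℕ) (ρ : ℝ) : Finset (Fin n → ℤ) := (finite_latticePt_norm_le ρ).toFinset

lemma mem_latticeBall {ρ : ℝ} {k : Fin n → ℤ} : k ∈ latticeBall n ρ ↔ ‖latticePt k‖ ≤ ρ := by
  simp [latticeBall]

lemma card_le_card_latticeBall {ρ : ℝ} {x : Rn n} {F : Finset (Fin n → ℤ)}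
    (hF : ∀ k ∈ F, ‖x - latticePt k‖ ≤ ρ) : F.card ≤ (latticeBall n (2 * ρ)).card := by
  rcases F.eq_empty_or_nonempty with rfl | ⟨l, hl⟩
  · simp
  refine Finset.card_le_card_of_injOn (fun k => k - l) (fun k hk => ?_)
    (fun _ _ _ _ h => sub_left_injective h)
  rw [Finset.mem_coe, mem_latticeBall, latticePt_sub]
  calc ‖latticePt k - latticePt l‖ = ‖(x - latticePt l) - (x - latticePt k)‖ := by congr 1; abel
    _ ≤ ‖x - latticePt l‖ + ‖x - latticePt k‖ := norm_sub_le _ _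
    _ ≤ 2 * ρ := by linarith [hF k hk, hF l hl]

lemma exists_radius_of_hasCompactSupport {f : Rn n → ℂ} (hf : HasCompactSupport f) :
    ∃ R > 0, ∀ x, R < ‖x‖ → f x = 0 := by
  obtain ⟨R, hR⟩ := hf.isBounded.exists_norm_le
  refine ⟨max R 1, by positivity, fun x hx => ?_⟩
  by_contra h
  exact absurd (hR x (subset_tsupport f h)) (not_le.2 ((le_max_left _ _).trans_lt hx))

/-- The total variation of the integer translates of a compactly supported `C¹` function between two
points is at most a multiple of the distance of the points, and bounded. -/
lemma exists_sum_translates_le {f : Rn n → ℂ} (hf : ContDiff ℝ 1 f) (hs : HasCompactSupport f) :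
    ∃ C, 0 ≤ C ∧ ∀ (x y : Rn n) (F : Finset (Fin n → ℤ)),
      ∑ k ∈ F, ‖f (x - latticePt k) - f (y - latticePt k)‖ ≤ C * min 1 ‖x - y‖ := by
  classical
  obtain ⟨L, hL⟩ := hf.lipschitzWith_of_hasCompactSupport hs (by simp)
  obtain ⟨A, hA⟩ := hf.continuous.bounded_above_of_compact_support hs
  obtain ⟨R, -, hR⟩ := exists_radius_of_hasCompactSupport hs
  have hA0 : 0 ≤ A := (norm_nonneg _).trans (hA 0)
  set N := (latticeBall n (2 * R)).card
  set B : ℝ := max (2 * A) L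
  have hB0 : 0 ≤ B := le_max_of_le_right L.2
  refine ⟨(2 * N : ℝ) * B, by positivity, fun x y F => ?_⟩
  have hterm : ∀ k, ‖f (x - latticePt k) - f (y - latticePt k)‖ ≤ B * min 1 ‖x - y‖ := fun k => by
    rcases le_total 1 ‖x - y‖ with h | h
    · rw [min_eq_left h, mul_one]
      refine le_trans ?_ (le_max_left _ _)
      exact (norm_sub_le _ _).trans (by linarith [hA (x - latticePt k), hA (y - latticePt k)])
    · rw [min_eq_right h]
      have := hL.norm_sub_le (x - latticePt k) (y - latticePt k)
      rw [sub_sub_sub_cancel_right] at this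
      exact this.trans (mul_le_mul_of_nonneg_right (le_max_right _ _) (norm_nonneg _))
  have hsub : F.filter (fun k => ‖f (x - latticePt k) - f (y - latticePt k)‖ ≠ 0) ⊆
      F.filter (fun k => ‖x - latticePt k‖ ≤ R) ∪ F.filter (fun k => ‖y - latticePt k‖ ≤ R) := by
    intro k hk
    simp only [Finset.mem_union, Finset.mem_filter] at hk ⊢
    by_contra h
    push Not at h
    have h1 := h.1 hk.1
    have h2 := h.2 hk.1
    exact hk.2 (by rw [hR _ h1, hR _ h2]; simp)
  have hcard : (F.filter (fun k => ‖f (x - latticePt k) - f (y - latticePt k)‖ ≠ 0)).card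
      ≤ 2 * N := by
    refine (Finset.card_le_card hsub).trans ((Finset.card_union_le _ _).trans ?_)
    have h1 : (F.filter (fun k => ‖x - latticePt k‖ ≤ R)).card ≤ N :=
      card_le_card_latticeBall (x := x) fun k hk => (Finset.mem_filter.1 hk).2
    have h2 : (F.filter (fun k => ‖y - latticePt k‖ ≤ R)).card ≤ N :=
      card_le_card_latticeBall (x := y) fun k hk => (Finset.mem_filter.1 hk).2
    omega
  rw [← Finset.sum_filter_ne_zero]
  calc _ ≤ (F.filter (fun k => ‖f (x - latticePt k) - f (y - latticePt k)‖ ≠ 0)).card •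
        (B * min 1 ‖x - y‖) := Finset.sum_le_card_nsmul _ _ _ fun k _ => hterm k
    _ ≤ (2 * N : ℝ) * (B * min 1 ‖x - y‖) := by
        rw [nsmul_eq_mul]
        gcongr
        exact_mod_cast hcard
    _ = _ := by ring

end Lattice

/-- Summation over the dyadic scales: the scales above and below `1 / d` contribute two geometric
series. -/
lemma exists_sum_zpow_min_le {s : ℝ} (hs0 : 0 < s) (hs1 : s < 1) :
    ∃ C, 0 ≤ C ∧ ∀ d : ℝ, 0 ≤ d → ∀ F : Finset ℤ,
      ∑ j ∈ F, (2 : ℝ) ^ (-(j : ℝ) * s) * min 1 ((2 : ℝ) ^ j * d) ≤ C * d ^ s := by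
  set q : ℝ := max ((2 : ℝ) ^ (-s)) ((2 : ℝ) ^ (-(1 - s)))
  have hq0 : 0 < q := lt_max_of_lt_left (by positivity)
  have hq1 : q < 1 := max_lt (Real.rpow_lt_one_of_one_lt_of_neg one_lt_two (by linarith))
    (Real.rpow_lt_one_of_one_lt_of_neg one_lt_two (by linarith))
  have hsum : Summable fun i : ℤ => q ^ i.natAbs := by
    apply Summable.of_nat_of_neg <;> simpa using summable_geometric_of_lt_one hq0.le hq1
  have hC0 : 0 ≤ ∑' i : ℤ, q ^ i.natAbs := tsum_nonneg fun i => by positivity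
  refine ⟨2 * ∑' i : ℤ, q ^ i.natAbs, by positivity, fun d hd F => ?_⟩
  rcases hd.eq_or_lt with rfl | hd
  · simp [Real.zero_rpow hs0.ne']
  obtain ⟨m, hm1, hm2⟩ := exists_mem_Ico_zpow hd one_lt_two
  -- Write `d = 2 ^ m * t` with `1 ≤ t < 2`, and compare the scale `j` with `-m`.
  have h2m : (0 : ℝ) < 2 ^ m := by positivity
  obtain ⟨t, rfl⟩ : ∃ t, d = 2 ^ m * t := ⟨d / 2 ^ m, by field_simp⟩
  have ht1 : 1 ≤ t := by
    by_contra h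
    push Not at h
    nlinarith
  have ht2 : t ≤ 2 := by
    rw [zpow_add_one₀ two_ne_zero] at hm2
    exact (lt_of_mul_lt_mul_left hm2 h2m.le).le
  have hts : 1 ≤ t ^ s := Real.one_le_rpow ht1 hs0.le
  have hterm : ∀ j : ℤ, (2 : ℝ) ^ (-(j : ℝ) * s) * min 1 ((2 : ℝ) ^ j * (2 ^ m * t)) ≤
      2 * (2 ^ m * t) ^ s * q ^ (j + m).natAbs := fun j => by
    have hms : (2 ^ m * t) ^ s = (2 : ℝ) ^ ((m : ℝ) * s) * t ^ s := by
      rw [Real.mul_rpow h2m.le (by linarith), Real.rpow_mul two_pos.le, Real.rpow_intCast]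
    rcases le_total 0 (j + m) with h | h
    · obtain ⟨N, hN⟩ := Int.eq_ofNat_of_zero_le h
      have hj : (j : ℝ) = N - m := by
        have : (j : ℝ) + m = N := by exact_mod_cast hN
        linarith
      have e1 : (2 : ℝ) ^ (-(j : ℝ) * s) = 2 ^ ((m : ℝ) * s) * ((2 : ℝ) ^ (-s)) ^ N := by
        rw [← Real.rpow_mul_natCast two_pos.le, ← Real.rpow_add two_pos, hj]; ring_nf
      have e2 : ((2 : ℝ) ^ (-s)) ^ N ≤ q ^ N := by gcongr; exact le_max_left _ _
      rw [hN, hms, e1, Int.natAbs_natCast]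
      calc _ ≤ (2 : ℝ) ^ ((m : ℝ) * s) * ((2 : ℝ) ^ (-s)) ^ N * 1 := by
            gcongr; exact min_le_left _ _
        _ ≤ (2 : ℝ) ^ ((m : ℝ) * s) * q ^ N * (2 * t ^ s) := by gcongr; linarith
        _ = _ := by ring
    · obtain ⟨N, hN⟩ := Int.eq_ofNat_of_zero_le (neg_nonneg.2 h)
      have hj : (j : ℝ) = -N - m := by
        have : -((j : ℝ) + m) = N := by exact_mod_cast hN
        linarith
      have hN' : (j + m).natAbs = N := by omega
      have e1 : (2 : ℝ) ^ (-(j : ℝ) * s) * ((2 : ℝ) ^ j * 2 ^ m) =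
          2 ^ ((m : ℝ) * s) * ((2 : ℝ) ^ (-(1 - s))) ^ N := by
        rw [← Real.rpow_mul_natCast two_pos.le, ← Real.rpow_add two_pos, ← Real.rpow_intCast,
          ← Real.rpow_intCast, ← Real.rpow_add two_pos, ← Real.rpow_add two_pos, hj]
        ring_nf
      have e2 : ((2 : ℝ) ^ (-(1 - s))) ^ N ≤ q ^ N := by gcongr; exact le_max_right _ _
      rw [hN', hms]
      calc _ ≤ (2 : ℝ) ^ (-(j : ℝ) * s) * ((2 : ℝ) ^ j * (2 ^ m * t)) := by
            gcongr; exact min_le_right _ _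
        _ = (2 : ℝ) ^ (-(j : ℝ) * s) * ((2 : ℝ) ^ j * 2 ^ m) * t := by ring
        _ = 2 ^ ((m : ℝ) * s) * ((2 : ℝ) ^ (-(1 - s))) ^ N * t := by rw [e1]
        _ ≤ (2 : ℝ) ^ ((m : ℝ) * s) * q ^ N * (2 * t ^ s) := by gcongr; linarith
        _ = _ := by ring
  calc _ ≤ ∑ j ∈ F, 2 * (2 ^ m * t) ^ s * q ^ (j + m).natAbs := Finset.sum_le_sum fun j _ => hterm j
    _ = 2 * (2 ^ m * t) ^ s * ∑ i ∈ F.map (addRightEmbedding m), q ^ i.natAbs := by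
        rw [Finset.sum_map, Finset.mul_sum]; rfl
    _ ≤ 2 * (2 ^ m * t) ^ s * ∑' i : ℤ, q ^ i.natAbs := by
        gcongr
        exact hsum.sum_le_tsum _ fun i _ => by positivity
    _ = _ := by ring

/-! ### Kantorovich duality on a compact metric space -/

section Kantorovich

variable {X : Type*} [MetricSpace X] [CompactSpace X] [MeasurableSpace X]

/-- The values `∫ φ dμ + ∫ ψ dν` over the pairs of continuous functions with
`u(x, y) ≤ φ(x) + ψ(y)`. -/
def dominatingValues (μ ν : Measure X) (u : C(X × X, ℝ)) : Set ℝ :=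
  {t | ∃ φ ψ : C(X, ℝ), (∀ x y, u (x, y) ≤ φ x + ψ y) ∧ t = ∫ x, φ x ∂μ + ∫ y, ψ y ∂ν}

/-- The sublinear functional `u ↦ inf {∫ φ dμ + ∫ ψ dν : u ≤ φ ⊕ ψ}` on `C(X × X)`. -/
def dominatingInf (μ ν : Measure X) (u : C(X × X, ℝ)) : ℝ := sInf (dominatingValues μ ν u)

lemma dominatingValues_nonempty (μ ν : Measure X) (u : C(X × X, ℝ)) :
    (dominatingValues μ ν u).Nonempty :=
  ⟨_, ContinuousMap.const X ‖u‖, 0, fun x y => by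
    simpa using (le_abs_self _).trans (u.norm_coe_le_norm (x, y)), rfl⟩

lemma integrable_continuousMap [BorelSpace X] (ρ : Measure X) [IsFiniteMeasure ρ] (f : C(X, ℝ)) :
    Integrable f ρ :=
  f.continuous.integrable_of_hasCompactSupport (HasCompactSupport.of_compactSpace f)

variable [BorelSpace X] {μ ν : Measure X} [IsProbabilityMeasure μ] [IsProbabilityMeasure ν]

lemma le_of_mem_dominatingValues {u : C(X × X, ℝ)} {t : ℝ} (ht : t ∈ dominatingValues μ ν u) :
    -‖u‖ ≤ t := by
  obtain ⟨φ, ψ, h, rfl⟩ := ht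
  have hφ := integrable_continuousMap μ φ
  have hψ := integrable_continuousMap ν ψ
  have h1 : ∀ x, -‖u‖ - φ x ≤ ∫ y, ψ y ∂ν := fun x => by
    calc -‖u‖ - φ x = ∫ _, (-‖u‖ - φ x) ∂ν := by simp
      _ ≤ ∫ y, ψ y ∂ν := integral_mono (integrable_const _) hψ fun y => by
          have := neg_le_of_abs_le (u.norm_coe_le_norm (x, y))
          have := h x y
          simp only
          linarith
  calc -‖u‖ = ∫ x, (-‖u‖ - φ x) ∂μ + ∫ x, φ x ∂μ := by
        rw [integral_sub (integrable_const _) hφ]; simp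
    _ ≤ ∫ _, (∫ y, ψ y ∂ν) ∂μ + ∫ x, φ x ∂μ := by
        gcongr
        · exact (integrable_const _).sub hφ
        · exact integrable_const _
        · exact h1
    _ = _ := by simp [add_comm]

lemma bddBelow_dominatingValues (u : C(X × X, ℝ)) : BddBelow (dominatingValues μ ν u) :=
  ⟨_, fun _ => le_of_mem_dominatingValues⟩

lemma dominatingInf_le {u : C(X × X, ℝ)} (φ ψ : C(X, ℝ)) (h : ∀ x y, u (x, y) ≤ φ x + ψ y) :
    dominatingInf μ ν u ≤ ∫ x, φ x ∂μ + ∫ y, ψ y ∂ν :=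
  csInf_le (bddBelow_dominatingValues u) ⟨φ, ψ, h, rfl⟩

lemma dominatingInf_smul_le {a : ℝ} (ha : 0 < a) (u : C(X × X, ℝ)) :
    dominatingInf μ ν (a • u) ≤ a * dominatingInf μ ν u := by
  rw [← div_le_iff₀' ha]
  refine le_csInf (dominatingValues_nonempty μ ν u) ?_
  rintro t ⟨φ, ψ, h, rfl⟩
  rw [div_le_iff₀' ha]
  refine (dominatingInf_le (a • φ) (a • ψ) fun x y => ?_).trans_eq ?_
  · simpa [← mul_add] using mul_le_mul_of_nonneg_left (h x y) ha.le
  · simp [integral_const_mul, mul_add]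

lemma dominatingInf_smul {a : ℝ} (ha : 0 < a) (u : C(X × X, ℝ)) :
    dominatingInf μ ν (a • u) = a * dominatingInf μ ν u := by
  refine le_antisymm (dominatingInf_smul_le ha u) ?_
  have := dominatingInf_smul_le (μ := μ) (ν := ν) (inv_pos.2 ha) (a • u)
  rw [smul_smul, inv_mul_cancel₀ ha.ne', one_smul] at this
  rwa [inv_mul_eq_div, le_div_iff₀' ha] at this

lemma dominatingInf_add_le (u v : C(X × X, ℝ)) :
    dominatingInf μ ν (u + v) ≤ dominatingInf μ ν u + dominatingInf μ ν v := by
  rw [← sub_le_iff_le_add]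
  refine le_csInf (dominatingValues_nonempty μ ν u) ?_
  rintro t ⟨φ, ψ, h, rfl⟩
  rw [sub_le_comm]
  refine le_csInf (dominatingValues_nonempty μ ν v) ?_
  rintro t ⟨φ', ψ', h', rfl⟩
  have := dominatingInf_le (μ := μ) (ν := ν) (u := u + v) (φ + φ') (ψ + ψ') fun x y => by
    have := h x y
    have := h' x y
    simp only [ContinuousMap.add_apply]
    linarith
  simp only [ContinuousMap.add_apply] at this
  rw [integral_add (integrable_continuousMap μ φ) (integrable_continuousMap μ φ'),
    integral_add (integrable_continuousMap ν ψ) (integrable_continuousMap ν ψ')] at this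
  linarith

/-- There is a linear functional on `C(X × X)` below `dominatingInf` which takes at a given `c` the
largest value of `∫ φ dμ + ∫ ψ dν` with `φ ⊕ ψ ≤ c`. -/
lemma exists_linearMap_le_dominatingInf (c : C(X × X, ℝ)) :
    ∃ Λ : C(X × X, ℝ) →ₗ[ℝ] ℝ, Λ c = -dominatingInf μ ν (-c) ∧
      ∀ u, Λ u ≤ dominatingInf μ ν u := by
  have h0 : dominatingInf μ ν (0 : C(X × X, ℝ)) = 0 := by
    have := dominatingInf_smul (μ := μ) (ν := ν) (two_pos : (0 : ℝ) < 2) 0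
    rw [smul_zero] at this
    linarith
  by_cases hc : c = 0
  · subst hc
    obtain ⟨g, -, hg⟩ := exists_extension_of_le_sublinear (E := C(X × X, ℝ)) ⟨⊥, 0⟩
      (dominatingInf μ ν) (fun a ha u => dominatingInf_smul ha u) dominatingInf_add_le
      (fun x => by
        have : (x : C(X × X, ℝ)) = 0 := (Submodule.mem_bot ℝ).1 x.2
        simp [this, h0])
    exact ⟨g, by simp [h0], hg⟩
  · let P : C(X × X, ℝ) →ₗ.[ℝ] ℝ := LinearPMap.mkSpanSingleton c (-dominatingInf μ ν (-c)) hc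
    have hdom : ∀ x : P.domain, P x ≤ dominatingInf μ ν x := by
      rintro ⟨x, hx⟩
      obtain ⟨a, rfl⟩ := Submodule.mem_span_singleton.1 hx
      simp only [P, LinearPMap.mkSpanSingleton'_apply]
      simp only [RingHom.id_apply, smul_eq_mul]
      rcases lt_trichotomy a 0 with ha | rfl | ha
      · have := dominatingInf_smul (μ := μ) (ν := ν) (neg_pos.2 ha) (-c)
        rw [neg_smul_neg] at this
        rw [this]; linarith
      · simp [h0]
      · rw [dominatingInf_smul ha]
        have := dominatingInf_add_le (μ := μ) (ν := ν) c (-c)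
        rw [add_neg_cancel, h0] at this
        gcongr
        linarith
    obtain ⟨g, hg, hg'⟩ := exists_extension_of_le_sublinear P
      (dominatingInf μ ν) (fun a ha u => dominatingInf_smul ha u) dominatingInf_add_le hdom
    refine ⟨g, ?_, hg'⟩
    refine (hg ⟨c, Submodule.mem_span_singleton_self c⟩).trans ?_
    exact LinearPMap.mkSpanSingleton_apply ℝ ℝ hc _

/-- Kantorovich duality: if `∫ φ dμ + ∫ ψ dν ≤ D` whenever `φ ⊕ ψ ≤ c`, then some coupling has cost
at most `D`. The coupling represents, by the Riesz–Markov–Kakutani theorem, a positive functional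
obtained from the Hahn–Banach theorem. -/
theorem exists_coupling_integral_le (c : C(X × X, ℝ)) (D : ℝ)
    (h : ∀ φ ψ : C(X, ℝ), (∀ x y, φ x + ψ y ≤ c (x, y)) → ∫ x, φ x ∂μ + ∫ y, ψ y ∂ν ≤ D) :
    ∃ γ : Measure (X × X), IsFiniteMeasure γ ∧ γ.map Prod.fst = μ ∧ γ.map Prod.snd = ν ∧
      ∫ z, c z ∂γ ≤ D := by
  obtain ⟨Λ, hΛc, hΛ⟩ := exists_linearMap_le_dominatingInf (μ := μ) (ν := ν) c
  have hle : ∀ (u : C(X × X, ℝ)) (φ ψ : C(X, ℝ)), (∀ x y, u (x, y) ≤ φ x + ψ y) →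
      Λ u ≤ ∫ x, φ x ∂μ + ∫ y, ψ y ∂ν :=
    fun u φ ψ hu => (hΛ u).trans (dominatingInf_le φ ψ hu)
  have heq : ∀ (u : C(X × X, ℝ)) (φ ψ : C(X, ℝ)), (∀ x y, u (x, y) = φ x + ψ y) →
      Λ u = ∫ x, φ x ∂μ + ∫ y, ψ y ∂ν := fun u φ ψ hu => by
    refine le_antisymm (hle u φ ψ fun x y => (hu x y).le) ?_
    have := hle (-u) (-φ) (-ψ) fun x y => by simp [hu x y, add_comm]
    simp only [map_neg, ContinuousMap.neg_apply, integral_neg] at this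
    linarith
  have hpos : ∀ u : C(X × X, ℝ), (∀ z, 0 ≤ u z) → 0 ≤ Λ u := fun u hu => by
    have := hle (-u) 0 0 fun x y => by simpa using hu (x, y)
    simpa using this
  have hD : Λ c ≤ D := by
    rw [hΛc, neg_le]
    refine le_csInf (dominatingValues_nonempty μ ν _) ?_
    rintro t ⟨φ, ψ, h', rfl⟩
    have := h (-φ) (-ψ) fun x y => by
      have := h' x y
      simp only [ContinuousMap.neg_apply] at this ⊢
      linarith
    simp only [ContinuousMap.neg_apply, integral_neg] at this
    linarith
  let Λ' : CompactlySupportedContinuousMap (X × X) ℝ →ₚ[ℝ] ℝ := PositiveLinearMap.mk₀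
    { toFun := fun u => Λ u.toContinuousMap
      map_add' := fun u v => Λ.map_add u.toContinuousMap v.toContinuousMap
      map_smul' := fun a u => Λ.map_smul a u.toContinuousMap } fun u hu => hpos _ hu
  have hint : ∀ u : C(X × X, ℝ), ∫ z, u z ∂(RealRMK.rieszMeasure Λ') = Λ u := fun u =>
    RealRMK.integral_rieszMeasure Λ' (CompactlySupportedContinuousMap.continuousMapEquiv u)
  refine ⟨RealRMK.rieszMeasure Λ', inferInstance, ?_, ?_, (hint c).trans_le hD⟩
  · refine ext_of_forall_integral_eq_of_IsFiniteMeasure fun f => ?_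
    rw [integral_map measurable_fst.aemeasurable f.continuous.aestronglyMeasurable]
    have := hint (f.toContinuousMap.comp ContinuousMap.fst)
    rw [heq _ f.toContinuousMap 0 fun x y => by simp] at this
    simpa using this
  · refine ext_of_forall_integral_eq_of_IsFiniteMeasure fun f => ?_
    rw [integral_map measurable_snd.aemeasurable f.continuous.aestronglyMeasurable]
    have := hint (f.toContinuousMap.comp ContinuousMap.snd)
    rw [heq _ 0 f.toContinuousMap fun x y => by simp] at this
    simpa using this

end Kantorovich

/-- Duality for the `s`-Wasserstein distance of measures carried by a compact set: it is at most any
bound for the differences `∫ f dμ - ∫ f dν` over the real `s`-Hölder functions of seminorm `1`. -/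
theorem wassersteinDist_le_of_forall_holder {n : ℕ} {K : Set (Rn n)} (hK : IsCompact K) {s : ℝ}
    (hs0 : 0 < s) (hs1 : s ≤ 1) {μ ν : Measure (Rn n)} [IsProbabilityMeasure μ]
    [IsProbabilityMeasure ν] (hμ : μ Kᶜ = 0) (hν : ν Kᶜ = 0) (D : ℝ)
    (h : ∀ f : Rn n → ℝ, (∀ x y, |f x - f y| ≤ ‖x - y‖ ^ s) → ∫ x, f x ∂μ - ∫ x, f x ∂ν ≤ D) :
    wassersteinDist s μ ν ≤ D := by
  have hKm := hK.measurableSet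
  have : CompactSpace K := isCompact_iff_compactSpace.1 hK
  have hemb : MeasurableEmbedding (Subtype.val : K → Rn n) := .subtype_coe hKm
  have hmap : ∀ ρ : Measure (Rn n), ρ Kᶜ = 0 →
      (ρ.comap (Subtype.val : K → Rn n)).map Subtype.val = ρ := fun ρ hρ => by
    rw [hemb.map_comap, Subtype.range_coe]
    exact Measure.restrict_eq_self_of_ae_mem (mem_ae_iff.2 hρ)
  have hprob : ∀ ρ : Measure (Rn n), IsProbabilityMeasure ρ → ρ Kᶜ = 0 →
      IsProbabilityMeasure (ρ.comap (Subtype.val : K → Rn n)) := fun ρ hp hρ => by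
    constructor
    rw [hemb.comap_apply, Set.image_univ, Subtype.range_coe, ← prob_compl_eq_zero_iff hKm, hρ]
  have := hprob μ inferInstance hμ
  have := hprob ν inferInstance hν
  have hne : Nonempty K := by
    by_contra hne
    have : K = ∅ := Set.not_nonempty_iff_eq_empty'.1 hne
    simp [this] at hμ
  let c : C(K × K, ℝ) := ⟨fun z => ‖(z.1 : Rn n) - z.2‖ ^ s, by
    have : Continuous fun z : K × K => ‖(z.1 : Rn n) - z.2‖ := by fun_prop
    exact this.rpow_const fun _ => Or.inr hs0.le⟩
  have hDc : ∀ φ ψ : C(K, ℝ), (∀ x y, φ x + ψ y ≤ c (x, y)) →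
      ∫ x, φ x ∂(μ.comap (Subtype.val : K → Rn n)) + ∫ y, ψ y ∂(ν.comap (Subtype.val : K → Rn n))
        ≤ D := by
    intro φ ψ hφψ
    -- The `c`-transform of `ψ` is an `s`-Hölder function on the whole space.
    let f : Rn n → ℝ := fun x => ⨅ y : K, (‖x - y‖ ^ s - ψ y)
    have hbdd : ∀ x : Rn n, BddBelow (Set.range fun y : K => ‖x - y‖ ^ s - ψ y) := fun x => by
      refine ⟨-‖ψ‖, ?_⟩
      rintro _ ⟨y, rfl⟩
      have h1 := le_of_abs_le (ψ.norm_coe_le_norm y)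
      have h2 : 0 ≤ ‖x - y‖ ^ s := by positivity
      simp only
      linarith
    have hsub : ∀ x y, f x ≤ ‖x - y‖ ^ s + f y := fun x y => by
      rw [← sub_le_iff_le_add']
      refine le_ciInf fun w => ?_
      rw [sub_le_iff_le_add']
      refine (ciInf_le (hbdd x) w).trans ?_
      have h1 : ‖x - w‖ ≤ ‖x - y‖ + ‖y - w‖ := norm_sub_le_norm_sub_add_norm_sub _ _ _
      have h2 : ‖x - w‖ ^ s ≤ ‖x - y‖ ^ s + ‖y - w‖ ^ s :=
        (Real.rpow_le_rpow (norm_nonneg _) h1 hs0.le).trans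
          (Real.rpow_add_le_add_rpow (norm_nonneg _) (norm_nonneg _) hs0.le hs1)
      linarith
    have hf : ∀ x y, |f x - f y| ≤ ‖x - y‖ ^ s := fun x y => by
      have h1 := hsub x y
      have h2 := hsub y x
      rw [norm_sub_rev] at h2
      rw [abs_le]
      constructor <;> linarith
    have hfc : Continuous f := by
      rw [continuous_iff_continuousAt]
      intro x
      rw [ContinuousAt, tendsto_iff_dist_tendsto_zero]
      have h0 : Filter.Tendsto (fun y => ‖y - x‖ ^ s) (nhds x) (nhds 0) := by
        have : Continuous fun y : Rn n => ‖y - x‖ ^ s :=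
          (by fun_prop : Continuous fun y : Rn n => ‖y - x‖).rpow_const fun _ => Or.inr hs0.le
        simpa [Real.zero_rpow hs0.ne'] using this.tendsto x
      exact squeeze_zero (fun _ => dist_nonneg) (fun y => by rw [Real.dist_eq]; exact hf y x) h0
    have h1 := h f hf
    rw [← hmap μ hμ, ← hmap ν hν, hemb.integral_map, hemb.integral_map] at h1
    refine le_trans ?_ h1
    rw [sub_eq_add_neg, ← integral_neg]
    refine add_le_add (integral_mono (integrable_continuousMap _ φ)
      (integrable_continuousMap _ ⟨fun x : K => f x, by fun_prop⟩) fun x => ?_)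
      (integral_mono (integrable_continuousMap _ ψ)
      (integrable_continuousMap _ ⟨fun x : K => -f x, by fun_prop⟩) fun y => ?_)
    · refine le_ciInf fun y => ?_
      have := hφψ x y
      simp only [c, ContinuousMap.coe_mk] at this
      linarith
    · have := ciInf_le (hbdd y) y
      simp only [sub_self, norm_zero, Real.zero_rpow hs0.ne', zero_sub] at this
      simp only [f]
      linarith
  obtain ⟨γ, hγ, h1, h2, h3⟩ := exists_coupling_integral_le c D hDc
  have hval : Measurable (Prod.map Subtype.val Subtype.val : K × K → Rn n × Rn n) := by fun_prop
  have hplan : γ.map (Prod.map Subtype.val Subtype.val) ∈ transportPlans μ ν := by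
    constructor
    · rw [Measure.map_map measurable_fst hval, ← hmap μ hμ, ← h1,
        Measure.map_map measurable_subtype_coe measurable_fst]
      rfl
    · rw [Measure.map_map measurable_snd hval, ← hmap ν hν, ← h2,
        Measure.map_map measurable_subtype_coe measurable_snd]
      rfl
  have hc0 : ∀ z, 0 ≤ c z := fun z => by simp only [c, ContinuousMap.coe_mk]; positivity
  have hD0 : 0 ≤ D := (integral_nonneg hc0).trans h3
  refine ENNReal.toReal_le_of_le_ofReal hD0 ?_
  refine (iInf₂_le _ hplan).trans ?_
  rw [lintegral_map (by fun_prop) hval]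
  refine le_trans (le_of_eq ?_) (ENNReal.ofReal_le_ofReal h3)
  exact (ofReal_integral_eq_lintegral_ofReal (integrable_continuousMap γ c)
    (Filter.Eventually.of_forall hc0)).symm

/-! ### The wavelet distance is at most a multiple of the Wasserstein distance -/

section Upper

variable {n : ℕ} {α : Type*}

lemma dyadic_zero (f : Rn n → ℂ) (k : Fin n → ℤ) (x : Rn n) :
    dyadic f 0 k x = f (x - latticePt k) := by
  simp [dyadic]

lemma continuous_dyadic {f : Rn n → ℂ} (hf : Continuous f) (j : ℤ) (k : Fin n → ℤ) :
    Continuous (dyadic f j k) := by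
  unfold dyadic
  fun_prop

lemma norm_dyadic_le {f : Rn n → ℂ} {A : ℝ} (hA : ∀ x, ‖f x‖ ≤ A) (j : ℤ) (k : Fin n → ℤ)
    (x : Rn n) : ‖dyadic f j k x‖ ≤ (2 : ℝ) ^ ((n : ℝ) * (j : ℝ) / 2) * A := by
  rw [dyadic, norm_mul, Complex.norm_real, Real.norm_of_nonneg (by positivity)]
  gcongr
  exact hA _

lemma norm_dyadic_sub (f : Rn n → ℂ) (j : ℤ) (k : Fin n → ℤ) (x y : Rn n) :
    ‖dyadic f j k x - dyadic f j k y‖ = (2 : ℝ) ^ ((n : ℝ) * (j : ℝ) / 2) *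
      ‖f ((2 : ℝ) ^ j • x - latticePt k) - f ((2 : ℝ) ^ j • y - latticePt k)‖ := by
  rw [dyadic, dyadic, ← mul_sub, norm_mul, Complex.norm_real, Real.norm_of_nonneg (by positivity)]

/-- Integration against the density of a difference of two measures. -/
lemma integral_density_sub_mul {μ ν : Measure (Rn n)} [IsProbabilityMeasure μ]
    [IsProbabilityMeasure ν] (hμ : μ ≪ volume) (hν : ν ≪ volume) {g : Rn n → ℂ}
    (hgμ : Integrable g μ) (hgν : Integrable g ν) :
    ∫ x, ((density μ x - density ν x : ℝ) : ℂ) * g x = ∫ x, g x ∂μ - ∫ x, g x ∂ν := by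
  rw [← integral_rnDeriv_smul hμ, ← integral_rnDeriv_smul hν, ← integral_sub
    ((integrable_rnDeriv_smul_iff hμ).2 hgμ) ((integrable_rnDeriv_smul_iff hν).2 hgν)]
  refine integral_congr_ae (Filter.Eventually.of_forall fun x => ?_)
  simp [density, sub_mul]

lemma integrable_of_continuous_bounded {g : Rn n → ℂ} (hg : Continuous g) {A : ℝ}
    (hA : ∀ x, ‖g x‖ ≤ A) (ρ : Measure (Rn n)) [IsFiniteMeasure ρ] : Integrable g ρ :=
  Integrable.of_bound hg.aestronglyMeasurable A (Filter.Eventually.of_forall hA)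

lemma integrable_conj_dyadic {f : Rn n → ℂ} (hf : Continuous f) (hfs : HasCompactSupport f) (j : ℤ)
    (k : Fin n → ℤ) (ρ : Measure (Rn n)) [IsFiniteMeasure ρ] :
    Integrable (fun x => conj (dyadic f j k x)) ρ := by
  obtain ⟨A, hA⟩ := hf.bounded_above_of_compact_support hfs
  have hc : Continuous fun x => conj (dyadic f j k x) :=
    Complex.continuous_conj.comp (continuous_dyadic hf j k)
  exact integrable_of_continuous_bounded hc
    (fun x => (RCLike.norm_conj _).trans_le (norm_dyadic_le hA j k x)) ρ

lemma detailCoeff_eq_integral_sub {μ ν : Measure (Rn n)} [IsProbabilityMeasure μ]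
    [IsProbabilityMeasure ν] (hμ : μ ≪ volume) (hν : ν ≪ volume) {ψ : α → Rn n → ℂ}
    (hψ : ∀ ε, Continuous (ψ ε)) (hψs : ∀ ε, HasCompactSupport (ψ ε)) (ε : α) (j : ℤ)
    (k : Fin n → ℤ) :
    detailCoeff ψ (fun x => ((density μ x - density ν x : ℝ) : ℂ)) ε j k =
      ∫ x, conj (dyadic (ψ ε) j k x) ∂μ - ∫ x, conj (dyadic (ψ ε) j k x) ∂ν :=
  integral_density_sub_mul hμ hν (integrable_conj_dyadic (hψ ε) (hψs ε) j k μ)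
    (integrable_conj_dyadic (hψ ε) (hψs ε) j k ν)

variable [Fintype α]

/-- Hölder bound for the weighted wavelets, summed over any finite set of scales and positions. -/
lemma exists_sum_dyadic_sub_le {ψ : α → Rn n → ℂ} (hψ : ∀ ε, ContDiff ℝ 1 (ψ ε))
    (hψs : ∀ ε, HasCompactSupport (ψ ε)) {s : ℝ} (hs0 : 0 < s) (hs1 : s < 1) :
    ∃ C, 0 < C ∧ ∀ (j₀ : ℤ) (F : Finset (α × {j : ℤ // j₀ ≤ j} × (Fin n → ℤ))) (x y : Rn n),
      ∑ i ∈ F, (2 : ℝ) ^ (-((i.2.1 : ℤ) : ℝ) * (s + (n : ℝ) / 2)) *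
        ‖dyadic (ψ i.1) i.2.1 i.2.2 x - dyadic (ψ i.1) i.2.1 i.2.2 y‖ ≤ C * ‖x - y‖ ^ s := by
  classical
  choose A hA0 hA using fun ε => exists_sum_translates_le (hψ ε) (hψs ε)
  obtain ⟨B, hB0, hB⟩ := exists_sum_zpow_min_le hs0 hs1
  have hAs : 0 ≤ ∑ ε, A ε := Finset.sum_nonneg fun ε _ => hA0 ε
  refine ⟨(∑ ε, A ε) * B + 1, by positivity, fun j₀ F x y => ?_⟩
  have hsplit : ∀ (ε : α) (j : ℤ) (k : Fin n → ℤ), (2 : ℝ) ^ (-(j : ℝ) * (s + (n : ℝ) / 2)) *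
      ‖dyadic (ψ ε) j k x - dyadic (ψ ε) j k y‖ = (2 : ℝ) ^ (-(j : ℝ) * s) *
        ‖ψ ε ((2 : ℝ) ^ j • x - latticePt k) - ψ ε ((2 : ℝ) ^ j • y - latticePt k)‖ := by
    intro ε j k
    rw [norm_dyadic_sub, ← mul_assoc, ← Real.rpow_add two_pos]
    ring_nf
  set FJ : Finset {j : ℤ // j₀ ≤ j} := F.image fun i => i.2.1
  set FK : Finset (Fin n → ℤ) := F.image fun i => i.2.2
  have hF : F ⊆ Finset.univ ×ˢ FJ ×ˢ FK := fun i hi => by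
    simp only [Finset.mem_product, Finset.mem_univ, true_and]
    exact ⟨Finset.mem_image_of_mem _ hi, Finset.mem_image_of_mem _ hi⟩
  have hd : ∀ j : ℤ, ‖(2 : ℝ) ^ j • x - (2 : ℝ) ^ j • y‖ = (2 : ℝ) ^ j * ‖x - y‖ := fun j => by
    rw [← smul_sub, norm_smul, Real.norm_of_nonneg (by positivity)]
  calc _ ≤ ∑ i ∈ Finset.univ ×ˢ FJ ×ˢ FK, (2 : ℝ) ^ (-((i.2.1 : ℤ) : ℝ) * (s + (n : ℝ) / 2)) *
        ‖dyadic (ψ i.1) i.2.1 i.2.2 x - dyadic (ψ i.1) i.2.1 i.2.2 y‖ :=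
        Finset.sum_le_sum_of_subset_of_nonneg hF fun i _ _ => by positivity
    _ = ∑ ε, ∑ j ∈ FJ, (2 : ℝ) ^ (-((j : ℤ) : ℝ) * s) * ∑ k ∈ FK,
          ‖ψ ε ((2 : ℝ) ^ (j : ℤ) • x - latticePt k) -
            ψ ε ((2 : ℝ) ^ (j : ℤ) • y - latticePt k)‖ := by
        simp only [Finset.sum_product, hsplit, Finset.mul_sum]
    _ ≤ ∑ ε, ∑ j ∈ FJ, (2 : ℝ) ^ (-((j : ℤ) : ℝ) * s) *
        (A ε * min 1 ((2 : ℝ) ^ (j : ℤ) * ‖x - y‖)) := by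
        gcongr with ε _ j _
        exact (hA ε _ _ FK).trans_eq (by rw [hd])
    _ = ∑ ε, A ε * ∑ j ∈ FJ.map (Function.Embedding.subtype _), (2 : ℝ) ^ (-(j : ℝ) * s) *
        min 1 ((2 : ℝ) ^ j * ‖x - y‖) := by
        refine Finset.sum_congr rfl fun ε _ => ?_
        rw [Finset.sum_map, Finset.mul_sum]
        exact Finset.sum_congr rfl fun j _ => by simp only [Function.Embedding.subtype_apply]; ring
    _ ≤ ∑ ε, A ε * (B * ‖x - y‖ ^ s) := by
        gcongr with ε _
        · exact hA0 ε
        · exact hB _ (norm_nonneg _) _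
    _ = (∑ ε, A ε) * B * ‖x - y‖ ^ s := by rw [← Finset.sum_mul, mul_assoc]
    _ ≤ _ := by gcongr; linarith

lemma transportCost_ne_top {K : Set (Rn n)} (hK : IsCompact K) {s : ℝ} (hs : 0 < s)
    {μ ν : Measure (Rn n)} [IsProbabilityMeasure μ] [IsProbabilityMeasure ν]
    (hμ : μ Kᶜ = 0) (hν : ν Kᶜ = 0) :
    (⨅ γ ∈ transportPlans μ ν, ∫⁻ z, ENNReal.ofReal (‖z.1 - z.2‖ ^ s) ∂γ) ≠ ∞ := by
  obtain ⟨R, hR⟩ := hK.isBounded.exists_norm_le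
  have hmem : μ.prod ν ∈ transportPlans μ ν := by simp [transportPlans]
  refine ne_top_of_le_ne_top ?_ (iInf₂_le _ hmem)
  have h1 : ∀ᵐ z ∂μ.prod ν, z.1 ∈ K :=
    ae_of_ae_map measurable_fst.aemeasurable (by rw [hmem.1]; exact mem_ae_iff.2 hμ)
  have h2 : ∀ᵐ z ∂μ.prod ν, z.2 ∈ K :=
    ae_of_ae_map measurable_snd.aemeasurable (by rw [hmem.2]; exact mem_ae_iff.2 hν)
  have h3 : ∫⁻ z, ENNReal.ofReal (‖z.1 - z.2‖ ^ s) ∂μ.prod ν ≤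
      ∫⁻ _, ENNReal.ofReal ((R + R) ^ s) ∂μ.prod ν := by
    refine lintegral_mono_ae ?_
    filter_upwards [h1, h2] with z hz1 hz2
    gcongr
    exact (norm_sub_le _ _).trans (add_le_add (hR _ hz1) (hR _ hz2))
  refine ne_top_of_le_ne_top ?_ h3
  simp

/-- The finite partial sums of the wavelet distance are controlled, at every lowest level, by the
same multiple of the Wasserstein distance. -/
theorem exists_sum_waveletTerm_le {ψ : α → Rn n → ℂ} (hψ : ∀ ε, ContDiff ℝ 1 (ψ ε))
    (hψs : ∀ ε, HasCompactSupport (ψ ε)) {s : ℝ} (hs0 : 0 < s) (hs1 : s < 1) {K : Set (Rn n)}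
    (hK : IsCompact K) :
    ∃ C, 0 < C ∧ ∀ (j₀ : ℤ) (μ ν : Measure (Rn n)), IsAb2On K μ → IsAb2On K ν →
      ∀ F, ∑ i ∈ F, waveletTerm ψ s j₀ μ ν i ≤ C * wassersteinDist s μ ν := by
  obtain ⟨C, hC0, hC⟩ := exists_sum_dyadic_sub_le hψ hψs hs0 hs1
  refine ⟨C, hC0, fun j₀ μ ν hμ hν F => ?_⟩
  have := hμ.isProbabilityMeasure
  have := hν.isProbabilityMeasure
  have hplan : ∀ γ ∈ transportPlans μ ν, ENNReal.ofReal ((∑ i ∈ F, waveletTerm ψ s j₀ μ ν i) / C) ≤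
      ∫⁻ z, ENNReal.ofReal (‖z.1 - z.2‖ ^ s) ∂γ := by
    intro γ hγ
    have hcoeff : ∀ i ∈ F, ENNReal.ofReal (waveletTerm ψ s j₀ μ ν i) ≤ ∫⁻ z, ENNReal.ofReal
        ((2 : ℝ) ^ (-((i.2.1 : ℤ) : ℝ) * (s + (n : ℝ) / 2)) *
          ‖dyadic (ψ i.1) i.2.1 i.2.2 z.1 - dyadic (ψ i.1) i.2.1 i.2.2 z.2‖) ∂γ := by
      intro i _
      have hc := continuous_dyadic (hψ i.1).continuous i.2.1 i.2.2
      have hi := integrable_conj_dyadic (hψ i.1).continuous (hψs i.1) i.2.1 i.2.2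
      have hsm : Continuous fun x => conj (dyadic (ψ i.1) i.2.1 i.2.2 x) :=
        Complex.continuous_conj.comp hc
      have e1 := integral_map (μ := γ) measurable_fst.aemeasurable
        (f := fun x => conj (dyadic (ψ i.1) i.2.1 i.2.2 x)) hsm.aestronglyMeasurable
      have e2 := integral_map (μ := γ) measurable_snd.aemeasurable
        (f := fun x => conj (dyadic (ψ i.1) i.2.1 i.2.2 x)) hsm.aestronglyMeasurable
      have i1 : Integrable (fun z => conj (dyadic (ψ i.1) i.2.1 i.2.2 z.1)) γ :=
        (integrable_map_measure (μ := γ) (f := Prod.fst) hsm.aestronglyMeasurable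
        measurable_fst.aemeasurable).1 (by rw [hγ.1]; exact hi μ)
      have i2 : Integrable (fun z => conj (dyadic (ψ i.1) i.2.1 i.2.2 z.2)) γ :=
        (integrable_map_measure (μ := γ) (f := Prod.snd) hsm.aestronglyMeasurable
        measurable_snd.aemeasurable).1 (by rw [hγ.2]; exact hi ν)
      rw [hγ.1] at e1
      rw [hγ.2] at e2
      rw [waveletTerm, detailCoeff_eq_integral_sub hμ.absolutelyContinuous hν.absolutelyContinuous
        (fun ε => (hψ ε).continuous) hψs, e1, e2,
        ← integral_sub i1 i2, ENNReal.ofReal_mul (by positivity), ofReal_norm]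
      simp_rw [ENNReal.ofReal_mul (Real.rpow_nonneg two_pos.le _)]
      rw [lintegral_const_mul' _ _ ENNReal.ofReal_ne_top]
      gcongr
      refine (enorm_integral_le_lintegral_enorm _).trans_eq (lintegral_congr fun z => ?_)
      rw [← map_sub, ofReal_norm, ← ofReal_norm, RCLike.norm_conj, ofReal_norm]
    rw [ENNReal.ofReal_div_of_pos hC0]
    refine ENNReal.div_le_of_le_mul' ?_
    calc ENNReal.ofReal (∑ i ∈ F, waveletTerm ψ s j₀ μ ν i)
        = ∑ i ∈ F, ENNReal.ofReal (waveletTerm ψ s j₀ μ ν i) :=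
          ENNReal.ofReal_sum_of_nonneg fun i _ => by unfold waveletTerm; positivity
      _ ≤ ∑ i ∈ F, ∫⁻ z, ENNReal.ofReal
          ((2 : ℝ) ^ (-((i.2.1 : ℤ) : ℝ) * (s + (n : ℝ) / 2)) *
            ‖dyadic (ψ i.1) i.2.1 i.2.2 z.1 - dyadic (ψ i.1) i.2.1 i.2.2 z.2‖) ∂γ :=
          Finset.sum_le_sum hcoeff
      _ = ∫⁻ z, ENNReal.ofReal (∑ i ∈ F, (2 : ℝ) ^ (-((i.2.1 : ℤ) : ℝ) * (s + (n : ℝ) / 2)) *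
            ‖dyadic (ψ i.1) i.2.1 i.2.2 z.1 - dyadic (ψ i.1) i.2.1 i.2.2 z.2‖) ∂γ := by
          rw [← lintegral_finsetSum]
          · refine lintegral_congr fun z => ?_
            rw [ENNReal.ofReal_sum_of_nonneg fun i _ => by positivity]
          · intro i _
            have hc := continuous_dyadic (hψ i.1).continuous i.2.1 i.2.2
            have : Measurable fun z : Rn n × Rn n =>
                dyadic (ψ i.1) i.2.1 i.2.2 z.1 - dyadic (ψ i.1) i.2.1 i.2.2 z.2 :=
              (hc.measurable.comp measurable_fst).sub (hc.measurable.comp measurable_snd)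
            fun_prop
      _ ≤ ∫⁻ z, ENNReal.ofReal C * ENNReal.ofReal (‖z.1 - z.2‖ ^ s) ∂γ := by
          refine lintegral_mono fun z => ?_
          rw [← ENNReal.ofReal_mul hC0.le]
          exact ENNReal.ofReal_le_ofReal (hC j₀ F z.1 z.2)
      _ = _ := lintegral_const_mul' _ _ ENNReal.ofReal_ne_top
  rw [← div_le_iff₀' hC0]
  exact (ENNReal.ofReal_le_iff_le_toReal
    (transportCost_ne_top hK hs0 hμ.measure_compl hν.measure_compl)).1 (le_iInf₂ hplan)

end Upper

/-! ### The upper constant is unbounded as the lowest level decreases -/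

section UpperConst

variable {n : ℕ} {α : Type*} [Fintype α]

lemma exists_common_radius {ψ : α → Rn n → ℂ} (hψs : ∀ ε, HasCompactSupport (ψ ε)) :
    ∃ R > 0, ∀ ε x, R < ‖x‖ → ψ ε x = 0 := by
  choose R hR0 hR using fun ε => exists_radius_of_hasCompactSupport (hψs ε)
  have h0 : 0 ≤ ∑ ε, R ε := Finset.sum_nonneg fun ε _ => (hR0 ε).le
  refine ⟨∑ ε, R ε + 1, by positivity, fun ε x hx => hR ε x ?_⟩
  have := Finset.single_le_sum (fun ε _ => (hR0 ε).le) (Finset.mem_univ ε)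
  linarith

lemma signedSum_eq_sum {ψ : α → Rn n → ℂ} {R ρ : ℝ} (hR : ∀ ε x, R < ‖x‖ → ψ ε x = 0)
    (η : (Fin n → ℤ) → ℝ) {x : Rn n} (hx : ‖x‖ ≤ ρ) :
    signedSum ψ η x = ∑ k ∈ latticeBall n (ρ + R), ∑ ε, (η k : ℂ) * ψ ε (x - latticePt k) := by
  simp only [signedSum, dyadic_zero]
  refine tsum_eq_sum fun k hk => Finset.sum_eq_zero fun ε _ => ?_
  rw [mem_latticeBall, not_le] at hk
  rw [hR, mul_zero]
  have := norm_sub_norm_le (latticePt k) x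
  rw [norm_sub_rev] at this
  linarith

lemma bddAbove_signedSum_holder {ψ : α → Rn n → ℂ} (hψ : ∀ ε, ContDiff ℝ 1 (ψ ε))
    (hψs : ∀ ε, HasCompactSupport (ψ ε)) {s : ℝ} (hs0 : 0 < s) (hs1 : s < 1) :
    BddAbove {c : ℝ | ∃ x y η, x ≠ y ∧ IsSign η ∧
      c = ‖signedSum ψ η x - signedSum ψ η y‖ / ‖x - y‖ ^ s} := by
  choose A hA0 hA using fun ε => exists_sum_translates_le (hψ ε) (hψs ε)
  obtain ⟨R, -, hR⟩ := exists_common_radius hψs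
  refine ⟨∑ ε, A ε, ?_⟩
  rintro _ ⟨x, y, η, hxy, hη, rfl⟩
  have hd : 0 < ‖x - y‖ := norm_sub_pos_iff.2 hxy
  rw [div_le_iff₀ (by positivity)]
  have hmin : min 1 ‖x - y‖ ≤ ‖x - y‖ ^ s := by
    rcases le_total 1 ‖x - y‖ with h | h
    · rw [min_eq_left h]; exact Real.one_le_rpow h hs0.le
    · rw [min_eq_right h]
      simpa using Real.rpow_le_rpow_of_exponent_ge hd h hs1.le
  have hη1 : ∀ k, ‖(η k : ℂ)‖ = 1 := fun k => by
    rcases hη k with h | h <;> simp [h]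
  rw [signedSum_eq_sum hR η (le_max_left ‖x‖ ‖y‖), signedSum_eq_sum hR η (le_max_right ‖x‖ ‖y‖),
    ← Finset.sum_sub_distrib]
  set F := latticeBall n (max ‖x‖ ‖y‖ + R)
  calc _ ≤ ∑ k ∈ F, ∑ ε, ‖ψ ε (x - latticePt k) - ψ ε (y - latticePt k)‖ := by
        refine (norm_sum_le _ _).trans (Finset.sum_le_sum fun k _ => ?_)
        rw [← Finset.sum_sub_distrib]
        refine (norm_sum_le _ _).trans (Finset.sum_le_sum fun ε _ => ?_)
        rw [← mul_sub, norm_mul, hη1, one_mul]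
    _ = ∑ ε, ∑ k ∈ F, ‖ψ ε (x - latticePt k) - ψ ε (y - latticePt k)‖ := Finset.sum_comm
    _ ≤ ∑ ε, A ε * ‖x - y‖ ^ s := Finset.sum_le_sum fun ε _ =>
        (hA ε x y F).trans (mul_le_mul_of_nonneg_left hmin (hA0 ε))
    _ = _ := by rw [Finset.sum_mul]

lemma signedSum_sub_flip {ψ : α → Rn n → ℂ} (hψs : ∀ ε, HasCompactSupport (ψ ε)) (x : Rn n) :
    signedSum ψ (fun _ => 1) x - signedSum ψ (fun k => if k = 0 then -1 else 1) x =
      2 * ∑ ε, ψ ε x := by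
  obtain ⟨R, hR0, hR⟩ := exists_common_radius hψs
  rw [signedSum_eq_sum hR _ le_rfl, signedSum_eq_sum hR _ le_rfl, ← Finset.sum_sub_distrib,
    Finset.sum_eq_single 0]
  · simp [latticePt_zero]; ring
  · intro k _ hk; simp [hk]
  · intro h
    exact absurd (mem_latticeBall.2 (by rw [latticePt_zero, norm_zero]; positivity)) h

variable (S : OrthonormalWaveletSystem n α)

/-- The sum of the wavelet functions is not constant: a constant with vanishing integral is zero,
and the wavelet functions are linearly independent. -/
lemma OrthonormalWaveletSystem.exists_sum_ψ_ne [Nonempty α] :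
    ∃ x y, ∑ ε, S.ψ ε x ≠ ∑ ε, S.ψ ε y := by
  classical
  by_contra! h
  have hconst : (fun x => ∑ ε, S.ψ ε x) = fun _ => ∑ ε, S.ψ ε 0 := funext fun x => h x 0
  have hint : Integrable (fun x => ∑ ε, S.ψ ε x) volume :=
    integrable_finsetSum _ fun ε _ => S.integrable_ψ ε
  have hzero : ∑ ε, S.ψ ε 0 = 0 := by
    rw [hconst, integrable_const_iff] at hint
    rcases hint with h0 | hfin
    · exact h0
    · have h1 : ∫ x, ∑ ε, S.ψ ε x = 0 := by
        rw [integral_finsetSum _ fun ε _ => S.integrable_ψ ε]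
        exact Finset.sum_eq_zero fun ε _ => S.integral_ψ ε
      rw [hconst, integral_const] at h1
      have : IsFiniteMeasure (volume : Measure (Rn n)) := hfin
      rcases smul_eq_zero.1 h1 with h2 | h2
      · exact absurd h2 measureReal_univ_ne_zero
      · exact h2
  have hli := (S.orthonormal_ψ 0).comp (fun ε : α => (ε, (0 : Fin n → ℤ)))
    (fun _ _ hab => (Prod.ext_iff.1 hab).1)
  have hli := Fintype.linearIndependent_iff.1 hli.linearIndependent (fun _ => 1)
  have hsum : ∑ ε : α, (1 : ℂ) • (memLp_dyadic (S.memLp_ψ ε) 0 0).toLp (dyadic (S.ψ ε) 0 0) = 0 :=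
      by
    simp only [one_smul]
    have hfun : ∑ ε : α, dyadic (S.ψ ε) 0 0 = 0 := by
      funext x
      simp only [Finset.sum_apply, dyadic_zero, latticePt_zero, sub_zero, Pi.zero_apply]
      rw [h x 0, hzero]
    have hae : ((∑ ε : α, (memLp_dyadic (S.memLp_ψ ε) 0 0).toLp (dyadic (S.ψ ε) 0 0) : L2 n) :
        Rn n → ℂ) =ᵐ[volume] ∑ ε : α, dyadic (S.ψ ε) 0 0 := by
      refine (Lp.coeFn_finsetSum _ _).trans ?_
      have : ∀ᵐ x, ∀ ε : α, ((memLp_dyadic (S.memLp_ψ ε) 0 0).toLp (dyadic (S.ψ ε) 0 0)) x =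
          dyadic (S.ψ ε) 0 0 x := ae_all_iff.2 fun ε => MemLp.coeFn_toLp _
      filter_upwards [this] with x hx
      simp [Finset.sum_apply, hx]
    rw [hfun] at hae
    exact (Lp.eq_zero_iff_ae_eq_zero).2 hae
  obtain ⟨ε⟩ := ‹Nonempty α›
  exact one_ne_zero (hli hsum ε)

lemma OrthonormalWaveletSystem.a23_pos [Nonempty α] (hψ : ∀ ε, ContDiff ℝ 1 (S.ψ ε))
    (hψs : ∀ ε, HasCompactSupport (S.ψ ε)) {s : ℝ} (hs0 : 0 < s) (hs1 : s < 1) :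
    0 < a23 S.ψ s := by
  obtain ⟨x, y, hxy⟩ := S.exists_sum_ψ_ne
  have hne : x ≠ y := fun h => hxy (by rw [h])
  have hd : 0 < ‖x - y‖ := norm_sub_pos_iff.2 hne
  have hbdd := bddAbove_signedSum_holder hψ hψs hs0 hs1
  have hle : ∀ η, IsSign η → ‖signedSum S.ψ η x - signedSum S.ψ η y‖ ≤ a23 S.ψ s * ‖x - y‖ ^ s :=
    fun η hη => (div_le_iff₀ (by positivity)).1 (le_csSup hbdd ⟨x, y, η, hne, hη, rfl⟩)
  have h1 := hle (fun _ => 1) fun _ => Or.inl rfl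
  have h2 := hle (fun k => if k = 0 then -1 else 1) fun k => by
    by_cases hk : k = 0 <;> simp [hk]
  -- One of the two sign patterns separates `x` and `y`, as the difference of the sums does.
  have h3 : 0 < ‖2 * ∑ ε, S.ψ ε x - 2 * ∑ ε, S.ψ ε y‖ := by
    rw [norm_pos_iff, ← mul_sub]
    exact mul_ne_zero two_ne_zero (sub_ne_zero.2 hxy)
  rw [← signedSum_sub_flip hψs x, ← signedSum_sub_flip hψs y, sub_sub_sub_comm] at h3
  have h4 := h3.trans_le (norm_sub_le _ _)
  have h5 : 0 < a23 S.ψ s * ‖x - y‖ ^ s := by linarith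
  exact pos_of_mul_pos_left h5 (by positivity)

lemma a22_nonneg (ψ : α → Rn n → ℂ) {s : ℝ} (hs0 : 0 < s) (hs1 : s < 1) : 0 ≤ a22 ψ s := by
  have h1 : 0 ≤ supSum ψ := Real.sSup_nonneg (by rintro _ ⟨x, η, -, rfl⟩; positivity)
  have h2 : 0 ≤ ∑ i, supSumDeriv ψ i := Finset.sum_nonneg fun i _ =>
    Real.sSup_nonneg (by rintro _ ⟨x, η, -, rfl⟩; positivity)
  have h3 : 1 < (2 : ℝ) ^ (1 - s) := Real.one_lt_rpow one_lt_two (by linarith)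
  have h4 : (2 : ℝ) ^ (-s) < 1 := Real.rpow_lt_one_of_one_lt_of_neg one_lt_two (by linarith)
  have h5 : 0 < (2 : ℝ) ^ (1 - s) - 1 := by linarith
  have h6 : 0 < 1 - (2 : ℝ) ^ (-s) := by linarith
  exact add_nonneg (div_nonneg h2 (by positivity)) (div_nonneg (by linarith) h6.le)

lemma upperConst_nonneg (ψ : α → Rn n → ℂ) {s : ℝ} (hs0 : 0 < s) (hs1 : s < 1) (j₀ : ℤ) :
    0 ≤ upperConst ψ s j₀ := by
  have h1 := a22_nonneg ψ hs0 hs1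
  have h2 : 0 ≤ a23 ψ s := Real.sSup_nonneg (by rintro _ ⟨x, y, η, -, -, rfl⟩; positivity)
  unfold upperConst
  split_ifs <;> positivity

/-- The upper constant tends to infinity as the lowest level tends to `-∞`. -/
lemma OrthonormalWaveletSystem.exists_le_upperConst [Nonempty α]
    (hψ : ∀ ε, ContDiff ℝ 1 (S.ψ ε)) (hψs : ∀ ε, HasCompactSupport (S.ψ ε)) {s : ℝ} (hs0 : 0 < s)
    (hs1 : s < 1) (C : ℝ) : ∃ J : ℤ, ∀ j₀ ≤ J, C ≤ upperConst S.ψ s j₀ := by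
  have ha := S.a23_pos hψ hψs hs0 hs1
  refine ⟨min (-1) (-⌈C / a23 S.ψ s⌉), fun j₀ hj₀ => ?_⟩
  have h1 : j₀ < 0 := by have := hj₀.trans (min_le_left _ _); omega
  have h2 : C / a23 S.ψ s ≤ |(j₀ : ℝ)| := by
    have h3 : ⌈C / a23 S.ψ s⌉ ≤ -j₀ := by have := hj₀.trans (min_le_right _ _); omega
    have h4 : ((⌈C / a23 S.ψ s⌉ : ℤ) : ℝ) ≤ -j₀ := by exact_mod_cast h3
    exact ((Int.le_ceil _).trans h4).trans (neg_le_abs _)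
  rw [upperConst, if_pos h1]
  have := (div_le_iff₀ ha).1 h2
  linarith [a22_nonneg S.ψ hs0 hs1]

end UpperConst

/-! ### Orthogonal projections in a Hilbert space -/

section Projection

variable {E : Type*} [NormedAddCommGroup E] [InnerProductSpace ℂ E]

lemma sum_inner_smul_mem {ι : Type*} {e : ι → E} {U : Submodule ℂ E}
    (hU : (Submodule.span ℂ (Set.range e)).topologicalClosure = U) (u : E) (F : Finset ι) :
    ∑ i ∈ F, inner ℂ (e i) u • e i ∈ U := by
  rw [← hU]
  exact Submodule.sum_mem _ fun i _ => Submodule.smul_mem _ _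
    (Submodule.le_topologicalClosure _ (Submodule.subset_span ⟨i, rfl⟩))

/-- A vector with finitely many nonzero coefficients with respect to an orthonormal family has a
finite orthogonal expansion. -/
lemma sub_sum_inner_smul_mem_orthogonal {ι : Type*} {e : ι → E} (he : Orthonormal ℂ e)
    {U : Submodule ℂ E} (hU : (Submodule.span ℂ (Set.range e)).topologicalClosure = U) {u : E}
    {F : Finset ι} (hF : ∀ i ∉ F, inner ℂ (e i) u = 0) :
    u - ∑ i ∈ F, inner ℂ (e i) u • e i ∈ Uᗮ := by
  classical
  rw [← hU, Submodule.orthogonal_closure]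
  have h : Submodule.span ℂ (Set.range e) ≤ (ℂ ∙ (u - ∑ i ∈ F, inner ℂ (e i) u • e i))ᗮ := by
    rw [Submodule.span_le]
    rintro _ ⟨i, rfl⟩
    rw [SetLike.mem_coe, Submodule.mem_orthogonal_singleton_iff_inner_left, inner_sub_right]
    by_cases hi : i ∈ F
    · rw [he.inner_right_sum _ hi, sub_self]
    · rw [hF i hi, inner_sum, Finset.sum_eq_zero, sub_zero]
      intro k hk
      rw [inner_smul_right, he.2 (fun h : i = k => hi (by rwa [h])), mul_zero]
  exact fun z hz => Submodule.mem_orthogonal_singleton_iff_inner_left.1 (h hz)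

/-- The components in `V` and in its complement in `V'` add up to the component in `V'`. -/
lemma sub_add_mem_orthogonal {V V' : Submodule ℂ E} [V.HasOrthogonalProjection] (hV : V ≤ V')
    {u v w : E} (hv : v ∈ V) (huv : u - v ∈ Vᗮ) (hw : w ∈ Vᗮ ⊓ V') (huw : u - w ∈ (Vᗮ ⊓ V')ᗮ) :
    u - (v + w) ∈ V'ᗮ := by
  intro z hz
  have h1 : z - V.starProjection z ∈ Vᗮ ⊓ V' :=
    ⟨V.sub_starProjection_mem_orthogonal z, V'.sub_mem hz (hV (V.starProjection_apply_mem z))⟩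
  have h2 := V.starProjection_apply_mem z
  have e1 : inner ℂ (V.starProjection z) (u - v) = 0 := huv _ h2
  have e2 : inner ℂ (V.starProjection z) w = 0 := hw.1 _ h2
  have e3 : inner ℂ (z - V.starProjection z) (u - w) = 0 := huw _ h1
  have e4 : inner ℂ (z - V.starProjection z) v = 0 := by
    rw [← inner_conj_symm, h1.1 v hv, map_zero]
  have e5 : inner ℂ z (u - (v + w)) = inner ℂ (V.starProjection z) (u - v) -
      inner ℂ (V.starProjection z) w + inner ℂ (z - V.starProjection z) (u - w) -
      inner ℂ (z - V.starProjection z) v := by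
    simp only [inner_sub_left, inner_sub_right, inner_add_right]
    ring
  rw [e5, e1, e2, e3, e4]
  simp

end Projection

/-! ### Pairing Hölder functions with dyadic functions -/

section Pairing

variable {n : ℕ}

lemma IsHolder.continuous {s H : ℝ} (hs : 0 < s) {f : Rn n → ℂ} (hf : IsHolder s H f) :
    Continuous f := by
  rw [continuous_iff_continuousAt]
  intro x
  rw [ContinuousAt, tendsto_iff_norm_sub_tendsto_zero]
  have h0 : Filter.Tendsto (fun y => H * ‖y - x‖ ^ s) (nhds x) (nhds 0) := by
    have : Continuous fun y : Rn n => H * ‖y - x‖ ^ s :=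
      ((by fun_prop : Continuous fun y : Rn n => ‖y - x‖).rpow_const
        fun _ => Or.inr hs.le).const_mul H
    simpa [Real.zero_rpow hs.ne'] using this.tendsto x
  exact squeeze_zero (fun _ => norm_nonneg _) (fun y => hf y x) h0

lemma integral_mul_dyadic (f g : Rn n → ℂ) (j : ℤ) (k : Fin n → ℤ) :
    ∫ x, f x * dyadic g j k x = (((2 : ℝ) ^ (-((n : ℝ) * (j : ℝ) / 2)) : ℝ) : ℂ) *
      ∫ y, f (((2 : ℝ) ^ j)⁻¹ • (y + latticePt k)) * g y := by
  have h2 : (0 : ℝ) < (2 : ℝ) ^ j := by positivity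
  have h := Measure.integral_comp_smul (volume : Measure (Rn n))
    (fun z => f (((2 : ℝ) ^ j)⁻¹ • z) * g (z - latticePt k)) ((2 : ℝ) ^ j)
  simp only [smul_smul, inv_mul_cancel₀ h2.ne', one_smul, finrank_euclideanSpace_fin] at h
  have h' := integral_sub_right_eq_self (μ := (volume : Measure (Rn n)))
    (fun y => f (((2 : ℝ) ^ j)⁻¹ • (y + latticePt k)) * g y) (latticePt k)
  simp only [sub_add_cancel] at h'
  have e : ∀ x, f x * dyadic g j k x = (((2 : ℝ) ^ ((n : ℝ) * (j : ℝ) / 2) : ℝ) : ℂ) *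
      (f x * g ((2 : ℝ) ^ j • x - latticePt k)) := fun x => by rw [dyadic]; ring
  simp_rw [e]
  rw [integral_const_mul, h, h', Complex.real_smul, ← mul_assoc, ← Complex.ofReal_mul]
  congr 2
  rw [abs_of_pos (by positivity), ← Real.rpow_natCast, ← Real.rpow_intCast,
    ← Real.rpow_mul two_pos.le, ← Real.rpow_neg two_pos.le, ← Real.rpow_add two_pos]
  ring_nf

lemma integrable_mul_of_hasCompactSupport {f g : Rn n → ℂ} (hf : Continuous f) (hg : Continuous g)
    (hgs : HasCompactSupport g) : Integrable (fun x => f x * g x) :=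
  (hf.mul hg).integrable_of_hasCompactSupport hgs.mul_left

lemma bddAbove_holderDualNorm {s : ℝ} (hs : 0 < s) {g : Rn n → ℂ} (hg : Continuous g)
    (hgs : HasCompactSupport g) (hg0 : ∫ x, g x = 0) :
    BddAbove {c : ℝ | ∃ f : Rn n → ℂ, IsHolder s 1 f ∧ c = ‖∫ x, f x * g x‖} := by
  refine ⟨∫ x, ‖x‖ ^ s * ‖g x‖, ?_⟩
  rintro _ ⟨f, hf, rfl⟩
  have hgi := hg.integrable_of_hasCompactSupport hgs (μ := volume)
  have h1 : ∫ x, f x * g x = ∫ x, (f x - f 0) * g x := by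
    simp_rw [sub_mul]
    rw [integral_sub (integrable_mul_of_hasCompactSupport (hf.continuous hs) hg hgs)
      (hgi.const_mul _), integral_const_mul, hg0, mul_zero, sub_zero]
  rw [h1]
  refine norm_integral_le_of_norm_le ?_ (Filter.Eventually.of_forall fun x => ?_)
  · have hc : Continuous fun x : Rn n => ‖x‖ ^ s * ‖g x‖ :=
      (continuous_norm.rpow_const fun _ => Or.inr hs.le).mul hg.norm
    exact hc.integrable_of_hasCompactSupport hgs.norm.mul_left
  · rw [norm_mul]
    have := hf x 0
    rw [one_mul, sub_zero] at this
    gcongr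

/-- The dyadic scaling of the dual Hölder norm. -/
lemma norm_integral_mul_dyadic_le {s : ℝ} (hs : 0 < s) {f g : Rn n → ℂ} (hf : IsHolder s 1 f)
    (hg : Continuous g) (hgs : HasCompactSupport g) (hg0 : ∫ x, g x = 0) (j : ℤ) (k : Fin n → ℤ) :
    ‖∫ x, f x * dyadic g j k x‖ ≤
      (2 : ℝ) ^ (-(j : ℝ) * (s + (n : ℝ) / 2)) * holderDualNorm s g := by
  have h2 : (0 : ℝ) < (2 : ℝ) ^ j := by positivity
  set a : ℝ := (2 : ℝ) ^ ((j : ℝ) * s)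
  have ha : 0 < a := by positivity
  have hb : (((2 : ℝ) ^ j)⁻¹) ^ s = a⁻¹ := by
    rw [Real.inv_rpow h2.le, ← Real.rpow_intCast, ← Real.rpow_mul two_pos.le]
  have hH : IsHolder s 1 fun y => (a : ℂ) * f (((2 : ℝ) ^ j)⁻¹ • (y + latticePt k)) := fun x y => by
    rw [← mul_sub, norm_mul, Complex.norm_real, Real.norm_of_nonneg ha.le, one_mul]
    have h1 := hf (((2 : ℝ) ^ j)⁻¹ • (x + latticePt k)) (((2 : ℝ) ^ j)⁻¹ • (y + latticePt k))
    rw [← smul_sub, add_sub_add_right_eq_sub, norm_smul, Real.norm_of_nonneg (by positivity),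
      Real.mul_rpow (by positivity) (norm_nonneg _), one_mul, hb] at h1
    calc _ ≤ a * (a⁻¹ * ‖x - y‖ ^ s) := by gcongr
      _ = _ := by field_simp
  have h1 : ‖∫ y, (a : ℂ) * f (((2 : ℝ) ^ j)⁻¹ • (y + latticePt k)) * g y‖ ≤ holderDualNorm s g :=
    le_csSup (bddAbove_holderDualNorm hs hg hgs hg0) ⟨_, hH, rfl⟩
  simp_rw [mul_assoc] at h1
  rw [integral_const_mul, norm_mul, Complex.norm_real, Real.norm_of_nonneg ha.le] at h1
  rw [integral_mul_dyadic, norm_mul, Complex.norm_real, Real.norm_of_nonneg (by positivity)]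
  have e : (2 : ℝ) ^ (-((n : ℝ) * (j : ℝ) / 2)) = (2 : ℝ) ^ (-(j : ℝ) * (s + (n : ℝ) / 2)) * a := by
    rw [← Real.rpow_add two_pos]; ring_nf
  rw [e, mul_assoc]
  gcongr

/-- A Hölder function vanishing at the origin, paired with a dyadic function of the position `k`. -/
lemma norm_integral_mul_dyadic_le_of_zero {s : ℝ} (hs : 0 < s) {f g : Rn n → ℂ}
    (hf : IsHolder s 1 f) (hf0 : f 0 = 0) (hg : Integrable g) {R ρ : ℝ}
    (hR : ∀ x, R < ‖x‖ → g x = 0) (j : ℤ) {k : Fin n → ℤ} (hk : ‖latticePt k‖ ≤ ρ) :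
    ‖∫ x, f x * dyadic g j k x‖ ≤ (2 : ℝ) ^ (-((n : ℝ) * (j : ℝ) / 2)) *
      ((2 : ℝ) ^ (-(j : ℝ) * s) * (R + ρ) ^ s * ∫ x, ‖g x‖) := by
  rw [integral_mul_dyadic, norm_mul, Complex.norm_real, Real.norm_of_nonneg (by positivity)]
  gcongr
  rw [← integral_const_mul]
  refine norm_integral_le_of_norm_le (hg.norm.const_mul _) (Filter.Eventually.of_forall fun y => ?_)
  rcases lt_or_ge R ‖y‖ with h | h
  · simp [hR y h]
  · have h1 := hf (((2 : ℝ) ^ j)⁻¹ • (y + latticePt k)) 0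
    have h2 : ‖((2 : ℝ) ^ j)⁻¹ • (y + latticePt k)‖ ≤ ((2 : ℝ) ^ j)⁻¹ * (R + ρ) := by
      rw [norm_smul, Real.norm_of_nonneg (by positivity)]
      gcongr
      exact (norm_add_le _ _).trans (add_le_add h hk)
    have h0 : 0 ≤ R + ρ := add_nonneg ((norm_nonneg _).trans h) ((norm_nonneg _).trans hk)
    have h3 : (((2 : ℝ) ^ j)⁻¹ * (R + ρ)) ^ s = (2 : ℝ) ^ (-(j : ℝ) * s) * (R + ρ) ^ s := by
      rw [Real.mul_rpow (by positivity) h0, Real.inv_rpow (by positivity), ← Real.rpow_intCast,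
        ← Real.rpow_mul two_pos.le, ← Real.rpow_neg two_pos.le, neg_mul]
    rw [hf0, sub_zero, sub_zero, one_mul] at h1
    rw [norm_mul, ← h3]
    gcongr
    exact h1.trans (Real.rpow_le_rpow (norm_nonneg _) h2 hs.le)

lemma inner_toLp_toLp {f g : Rn n → ℂ} (hf : MemLp f 2 volume) (hg : MemLp g 2 volume) :
    inner ℂ (hf.toLp f) (hg.toLp g) = ∫ x, g x * conj (f x) := by
  rw [L2.inner_def]
  refine integral_congr_ae ?_
  filter_upwards [hf.coeFn_toLp, hg.coeFn_toLp] with x h1 h2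
  rw [h1, h2]
  simp

end Pairing

/-! ### Coefficients of a difference of measures carried by a ball -/

section Coefficients

variable {n : ℕ} {R ρ : ℝ} {g : Rn n → ℂ}

lemma dyadic_eq_zero_of_notMem (hR : ∀ x, R < ‖x‖ → g x = 0) {j : ℤ} {k : Fin n → ℤ}
    (hk : k ∉ latticeBall n ((2 : ℝ) ^ j * ρ + R)) {x : Rn n} (hx : ‖x‖ ≤ ρ) :
    dyadic g j k x = 0 := by
  rw [mem_latticeBall, not_le] at hk
  rw [dyadic, hR, mul_zero]
  have h1 := norm_sub_norm_le (latticePt k) ((2 : ℝ) ^ j • x)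
  have h2 : ‖(2 : ℝ) ^ j • x‖ ≤ (2 : ℝ) ^ j * ρ := by
    rw [norm_smul, Real.norm_of_nonneg (by positivity)]; gcongr
  rw [norm_sub_rev] at h1
  linarith

/-- At the levels `j ≥ j₀`, the dyadic functions which do not vanish on the ball of radius `ρ` live
on one common ball. -/
lemma dyadic_eq_zero_of_mem (hR : ∀ x, R < ‖x‖ → g x = 0) (hR0 : 0 < R) {j₀ j : ℤ} (hj : j₀ ≤ j)
    {k : Fin n → ℤ} (hk : k ∈ latticeBall n ((2 : ℝ) ^ j * ρ + R)) {x : Rn n}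
    (hx : ρ + ((2 : ℝ) ^ j₀)⁻¹ * (2 * R) < ‖x‖) : dyadic g j k x = 0 := by
  rw [mem_latticeBall] at hk
  rw [dyadic, hR, mul_zero]
  have h2 : (0 : ℝ) < (2 : ℝ) ^ j := by positivity
  have h1 := norm_sub_norm_le ((2 : ℝ) ^ j • x) (latticePt k)
  rw [norm_smul, Real.norm_of_nonneg h2.le] at h1
  have h3 : ((2 : ℝ) ^ j)⁻¹ ≤ ((2 : ℝ) ^ j₀)⁻¹ := by
    gcongr
    norm_num
  have h4 : ρ + ((2 : ℝ) ^ j)⁻¹ * (2 * R) < ‖x‖ := by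
    refine lt_of_le_of_lt ?_ hx
    gcongr
  have h5 := mul_lt_mul_of_pos_left h4 h2
  rw [mul_add, ← mul_assoc, mul_inv_cancel₀ h2.ne', one_mul] at h5
  linarith

variable {α : Type*} {ψ : α → Rn n → ℂ} {μ ν : Measure (Rn n)} [IsProbabilityMeasure μ]
  [IsProbabilityMeasure ν]

lemma detailCoeff_eq_zero (hψ : ∀ ε, Continuous (ψ ε)) (hψs : ∀ ε, HasCompactSupport (ψ ε))
    (hR : ∀ ε x, R < ‖x‖ → ψ ε x = 0) (hμ : μ ≪ volume) (hν : ν ≪ volume)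
    (hμρ : ∀ᵐ x ∂μ, ‖x‖ ≤ ρ) (hνρ : ∀ᵐ x ∂ν, ‖x‖ ≤ ρ) (ε : α) {j : ℤ} {k : Fin n → ℤ}
    (hk : k ∉ latticeBall n ((2 : ℝ) ^ j * ρ + R)) :
    detailCoeff ψ (fun x => ((density μ x - density ν x : ℝ) : ℂ)) ε j k = 0 := by
  rw [detailCoeff_eq_integral_sub hμ hν hψ hψs, integral_eq_zero_of_ae, integral_eq_zero_of_ae,
    sub_zero]
  · filter_upwards [hνρ] with x hx
    simp [dyadic_eq_zero_of_notMem (hR ε) hk hx]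
  · filter_upwards [hμρ] with x hx
    simp [dyadic_eq_zero_of_notMem (hR ε) hk hx]

/-- Both measures have mass one, so a coefficient is at most twice the oscillation of the dyadic
function. -/
lemma norm_detailCoeff_le (hψ : ∀ ε, Continuous (ψ ε)) (hψs : ∀ ε, HasCompactSupport (ψ ε))
    (hμ : μ ≪ volume) (hν : ν ≪ volume) (hμρ : ∀ᵐ x ∂μ, ‖x‖ ≤ ρ) (hνρ : ∀ᵐ x ∂ν, ‖x‖ ≤ ρ) (ε : α)
    {L : NNReal} (hL : LipschitzWith L (ψ ε)) (j : ℤ) (k : Fin n → ℤ) :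
    ‖detailCoeff ψ (fun x => ((density μ x - density ν x : ℝ) : ℂ)) ε j k‖ ≤
      2 * ((2 : ℝ) ^ ((n : ℝ) * (j : ℝ) / 2) * (L * ((2 : ℝ) ^ j * ρ))) := by
  have hosc : ∀ x, ‖x‖ ≤ ρ → ‖conj (dyadic (ψ ε) j k x) - conj (dyadic (ψ ε) j k 0)‖ ≤
      (2 : ℝ) ^ ((n : ℝ) * (j : ℝ) / 2) * (L * ((2 : ℝ) ^ j * ρ)) := fun x hx => by
    rw [← map_sub, RCLike.norm_conj, norm_dyadic_sub]
    have := hL.norm_sub_le ((2 : ℝ) ^ j • x - latticePt k) ((2 : ℝ) ^ j • 0 - latticePt k)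
    rw [sub_sub_sub_cancel_right, smul_zero, sub_zero, norm_smul,
      Real.norm_of_nonneg (by positivity)] at this
    rw [smul_zero]
    refine mul_le_mul_of_nonneg_left (this.trans ?_) (by positivity)
    gcongr
  have hb : ∀ (τ : Measure (Rn n)) [IsProbabilityMeasure τ], (∀ᵐ x ∂τ, ‖x‖ ≤ ρ) →
      ‖∫ x, conj (dyadic (ψ ε) j k x) ∂τ - conj (dyadic (ψ ε) j k 0)‖ ≤
        (2 : ℝ) ^ ((n : ℝ) * (j : ℝ) / 2) * (L * ((2 : ℝ) ^ j * ρ)) := fun τ _ hτ => by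
    have h1 : ∫ x, conj (dyadic (ψ ε) j k x) ∂τ - conj (dyadic (ψ ε) j k 0) =
        ∫ x, (conj (dyadic (ψ ε) j k x) - conj (dyadic (ψ ε) j k 0)) ∂τ := by
      rw [integral_sub (integrable_conj_dyadic (hψ ε) (hψs ε) j k τ) (integrable_const _)]
      simp
    rw [h1]
    refine (norm_integral_le_of_norm_le_const (hτ.mono hosc)).trans_eq ?_
    simp
  rw [detailCoeff_eq_integral_sub hμ hν hψ hψs]
  calc _ = ‖(∫ x, conj (dyadic (ψ ε) j k x) ∂μ - conj (dyadic (ψ ε) j k 0)) -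
        (∫ x, conj (dyadic (ψ ε) j k x) ∂ν - conj (dyadic (ψ ε) j k 0))‖ := by
        rw [sub_sub_sub_cancel_right]
    _ ≤ _ := (norm_sub_le _ _).trans (by linarith [hb μ hμρ, hb ν hνρ])

end Coefficients

/-! ### The Wasserstein distance is bounded by the wavelet distance, up to a small error -/

section Lower

variable {n : ℕ} {α : Type*}

lemma iSup_holderDualNorm_nonneg (ψ : α → Rn n → ℂ) (s : ℝ) : 0 ≤ ⨆ ε, holderDualNorm s (ψ ε) :=
  Real.iSup_nonneg fun _ => Real.sSup_nonneg (by rintro _ ⟨f, -, rfl⟩; positivity)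

lemma waveletTerm_nonneg (ψ : α → Rn n → ℂ) (s : ℝ) (j₀ : ℤ) (μ ν : Measure (Rn n)) (i) :
    0 ≤ waveletTerm ψ s j₀ μ ν i := by
  unfold waveletTerm
  positivity

variable [Fintype α] (S : OrthonormalWaveletSystem n α)

instance OrthonormalWaveletSystem.hasOrthogonalProjection_V (j : ℤ) :
    (S.V j).HasOrthogonalProjection :=
  have : CompleteSpace (S.V j) := (S.isClosed_V j).completeSpace_coe
  inferInstance

/-- The pairing of a Hölder function `f` with `μ - ν` is bounded by the wavelet distance and by the
pairing of `f` with the projection of the density to the space of the lowest level. This is the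
wavelet expansion of the density, paired with the restriction of `f` to a ball which carries all
the functions occurring in it. -/
theorem OrthonormalWaveletSystem.integral_sub_integral_le
    (hφc : Continuous S.φ) (hφs : HasCompactSupport S.φ)
    (hψc : ∀ ε, Continuous (S.ψ ε)) (hψs : ∀ ε, HasCompactSupport (S.ψ ε)) {s : ℝ} (hs : 0 < s)
    {R ρ : ℝ} (hR0 : 0 < R) (hRφ : ∀ x, R < ‖x‖ → S.φ x = 0)
    (hRψ : ∀ ε x, R < ‖x‖ → S.ψ ε x = 0)
    {μ ν : Measure (Rn n)} [IsProbabilityMeasure μ] [IsProbabilityMeasure ν] (hμ : μ ≪ volume)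
    (hν : ν ≪ volume) (hpμ : MemLp (density μ) 2 volume) (hpν : MemLp (density ν) 2 volume)
    (hμρ : ∀ᵐ x ∂μ, ‖x‖ ≤ ρ) (hνρ : ∀ᵐ x ∂ν, ‖x‖ ≤ ρ) {j₀ : ℤ}
    (hsum : Summable (waveletTerm S.ψ s j₀ μ ν))
    {f : Rn n → ℝ} (hf : ∀ x y, |f x - f y| ≤ ‖x - y‖ ^ s) :
    ∫ x, f x ∂μ - ∫ x, f x ∂ν ≤
      ‖∑ k ∈ latticeBall n ((2 : ℝ) ^ j₀ * ρ + R),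
        detailCoeff (fun _ : Unit => S.φ) (fun x => ((density μ x - density ν x : ℝ) : ℂ)) () j₀ k *
          ∫ x, (f x : ℂ) * dyadic S.φ j₀ k x‖ +
      (⨆ ε, holderDualNorm s (S.ψ ε)) * waveletDist S.ψ s j₀ μ ν := by
  classical
  set p : Rn n → ℂ := fun x => ((density μ x - density ν x : ℝ) : ℂ)
  set M : ℝ := ⨆ ε, holderDualNorm s (S.ψ ε)
  have hM0 : 0 ≤ M := iSup_holderDualNorm_nonneg S.ψ s
  have hfH : IsHolder s 1 fun x => (f x : ℂ) := fun x y => by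
    rw [one_mul, ← Complex.ofReal_sub, Complex.norm_real]
    exact hf x y
  have hfc : Continuous fun x => (f x : ℂ) := hfH.continuous hs
  have hp : MemLp p 2 volume := (hpμ.sub hpν).ofReal
  set P : L2 n := hp.toLp p
  -- All the dyadic functions occurring below live on the ball `B`.
  set r : ℝ := ρ + ((2 : ℝ) ^ j₀)⁻¹ * (2 * R)
  have hρr : ρ ≤ r := by
    have : 0 ≤ ((2 : ℝ) ^ j₀)⁻¹ * (2 * R) := by positivity
    linarith
  set B : Set (Rn n) := Metric.closedBall 0 r
  have hBm : MeasurableSet B := Metric.isClosed_closedBall.measurableSet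
  have hBc : IsCompact B := isCompact_closedBall 0 r
  have hmemB : ∀ x, x ∈ B ↔ ‖x‖ ≤ r := fun x => by simp [B]
  obtain ⟨A, hA⟩ := hBc.exists_bound_of_continuousOn hfc.continuousOn
  set fB : Rn n → ℂ := B.indicator fun x => (f x : ℂ)
  have hfBm : Measurable fB := hfc.measurable.indicator hBm
  have hfBconj : ∀ x, conj (fB x) = fB x := fun x => by
    by_cases hx : x ∈ B <;> simp [fB, hx]
  have hG : MemLp fB 2 volume := by
    rw [memLp_indicator_iff_restrict hBm]
    have : IsFiniteMeasure (volume.restrict B) := ⟨by simpa using hBc.measure_lt_top⟩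
    refine MemLp.of_bound hfc.aestronglyMeasurable A ?_
    exact (ae_restrict_iff' hBm).2 (Filter.Eventually.of_forall hA)
  set G : L2 n := hG.toLp fB
  have hfBint : ∀ (τ : Measure (Rn n)) [IsProbabilityMeasure τ], (∀ᵐ x ∂τ, ‖x‖ ≤ ρ) →
      Integrable fB τ ∧ ∫ x, fB x ∂τ = ((∫ x, f x ∂τ : ℝ) : ℂ) := fun τ _ hτ => by
    constructor
    · refine Integrable.of_bound hfBm.aestronglyMeasurable (max A 0)
        (Filter.Eventually.of_forall fun x => ?_)
      by_cases hx : x ∈ B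
      · simpa [fB, hx] using Or.inl (hA x hx)
      · simp [fB, hx]
    · rw [← integral_complex_ofReal]
      refine integral_congr_ae ?_
      filter_upwards [hτ] with x hx
      simp [fB, (hmemB x).2 (hx.trans hρr)]
  have hGP : inner ℂ G P = ((∫ x, f x ∂μ - ∫ x, f x ∂ν : ℝ) : ℂ) := by
    rw [inner_toLp_toLp]
    simp_rw [hfBconj]
    rw [integral_density_sub_mul hμ hν (hfBint μ hμρ).1 (hfBint ν hνρ).1, (hfBint μ hμρ).2,
      (hfBint ν hνρ).2, Complex.ofReal_sub]
  have hGdyadic : ∀ (g : Rn n → ℂ) (hg : MemLp g 2 volume), (∀ x, R < ‖x‖ → g x = 0) →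
      ∀ j, j₀ ≤ j → ∀ k ∈ latticeBall n ((2 : ℝ) ^ j * ρ + R),
      inner ℂ G ((memLp_dyadic hg j k).toLp (dyadic g j k)) =
        ∫ x, (f x : ℂ) * dyadic g j k x := fun g hg hgR j hj k hk => by
    rw [inner_toLp_toLp]
    refine integral_congr_ae (Filter.Eventually.of_forall fun x => ?_)
    simp only [hfBconj]
    by_cases hx : x ∈ B
    · simp [fB, hx, mul_comm]
    · rw [hmemB, not_le] at hx
      rw [dyadic_eq_zero_of_mem hgR hR0 hj hk hx]
      simp
  -- The projection to the lowest level.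
  set Q : ℤ → L2 n := fun j => (S.V j).starProjection P
  have hbase : inner ℂ G (Q j₀) = ∑ k ∈ latticeBall n ((2 : ℝ) ^ j₀ * ρ + R),
      detailCoeff (fun _ : Unit => S.φ) p () j₀ k * ∫ x, (f x : ℂ) * dyadic S.φ j₀ k x := by
    have hcoeff : ∀ k, inner ℂ ((memLp_dyadic S.memLp_φ j₀ k).toLp (dyadic S.φ j₀ k)) P =
        detailCoeff (fun _ : Unit => S.φ) p () j₀ k := fun k => inner_toLp_toLp _ _
    have hQ0 : Q j₀ = ∑ k ∈ latticeBall n ((2 : ℝ) ^ j₀ * ρ + R),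
        inner ℂ ((memLp_dyadic S.memLp_φ j₀ k).toLp (dyadic S.φ j₀ k)) P •
          (memLp_dyadic S.memLp_φ j₀ k).toLp (dyadic S.φ j₀ k) := by
      refine Submodule.eq_starProjection_of_mem_orthogonal
        (sum_inner_smul_mem (S.span_φ j₀) P _)
        (sub_sum_inner_smul_mem_orthogonal (S.orthonormal_φ j₀) (S.span_φ j₀) fun k hk => ?_)
      rw [hcoeff]
      exact detailCoeff_eq_zero (fun _ => hφc) (fun _ => hφs) (fun _ => hRφ) hμ hν hμρ hνρ () hk
    rw [hQ0, inner_sum]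
    refine Finset.sum_congr rfl fun k hk => ?_
    rw [inner_smul_right, hcoeff, hGdyadic S.φ S.memLp_φ hRφ j₀ le_rfl k hk]
  -- The passage from one level to the next.
  have hstep : ∀ j, j₀ ≤ j → inner ℂ G (Q (j + 1)) = inner ℂ G (Q j) +
      ∑ i ∈ Finset.univ ×ˢ latticeBall n ((2 : ℝ) ^ j * ρ + R),
        detailCoeff S.ψ p i.1 j i.2 * ∫ x, (f x : ℂ) * dyadic (S.ψ i.1) j i.2 x := by
    intro j hj
    set e : α × (Fin n → ℤ) → L2 n := fun i =>
      (memLp_dyadic (S.memLp_ψ i.1) j i.2).toLp (dyadic (S.ψ i.1) j i.2)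
    set F : Finset (α × (Fin n → ℤ)) := Finset.univ ×ˢ latticeBall n ((2 : ℝ) ^ j * ρ + R)
    have hcoeff : ∀ i, inner ℂ (e i) P = detailCoeff S.ψ p i.1 j i.2 := fun i =>
      inner_toLp_toLp _ _
    have hw : ∑ i ∈ F, inner ℂ (e i) P • e i ∈ (S.V j)ᗮ ⊓ S.V (j + 1) :=
      sum_inner_smul_mem (S.span_ψ j) P F
    have hPw : P - ∑ i ∈ F, inner ℂ (e i) P • e i ∈ ((S.V j)ᗮ ⊓ S.V (j + 1))ᗮ := by
      refine sub_sum_inner_smul_mem_orthogonal (S.orthonormal_ψ j) (S.span_ψ j) fun i hi => ?_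
      have hi2 : i.2 ∉ latticeBall n ((2 : ℝ) ^ j * ρ + R) := fun h =>
        hi (Finset.mem_product.2 ⟨Finset.mem_univ _, h⟩)
      rw [hcoeff]
      exact detailCoeff_eq_zero hψc hψs hRψ hμ hν hμρ hνρ i.1 hi2
    have hmono : S.V j ≤ S.V (j + 1) := S.monotone_V (by omega)
    have hQ1 : Q (j + 1) = Q j + ∑ i ∈ F, inner ℂ (e i) P • e i :=
      Submodule.eq_starProjection_of_mem_orthogonal
        (Submodule.add_mem _ (hmono (Submodule.starProjection_apply_mem _ _)) hw.2)
        (sub_add_mem_orthogonal hmono (Submodule.starProjection_apply_mem _ _)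
          ((S.V j).sub_starProjection_mem_orthogonal P) hw hPw)
    rw [hQ1, inner_add_right, inner_sum]
    congr 1
    refine Finset.sum_congr rfl fun i hi => ?_
    rw [inner_smul_right, hcoeff,
      hGdyadic _ (S.memLp_ψ i.1) (hRψ i.1) j hj i.2 (Finset.mem_product.1 hi).2]
  have hterm : ∀ i : α × {j : ℤ // j₀ ≤ j} × (Fin n → ℤ),
      ‖detailCoeff S.ψ p i.1 i.2.1 i.2.2 * ∫ x, (f x : ℂ) * dyadic (S.ψ i.1) i.2.1 i.2.2 x‖ ≤
        M * waveletTerm S.ψ s j₀ μ ν i := fun i => by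
    have h1 := norm_integral_mul_dyadic_le hs hfH (hψc i.1) (hψs i.1) (S.integral_ψ i.1)
      (i.2.1 : ℤ) i.2.2
    have h2 : holderDualNorm s (S.ψ i.1) ≤ M :=
      le_ciSup (f := fun ε => holderDualNorm s (S.ψ ε)) (Set.finite_range _).bddAbove i.1
    rw [norm_mul, waveletTerm]
    calc _ ≤ ‖detailCoeff S.ψ p i.1 i.2.1 i.2.2‖ *
          ((2 : ℝ) ^ (-((i.2.1 : ℤ) : ℝ) * (s + (n : ℝ) / 2)) * M) := by
          gcongr
          exact h1.trans (by gcongr)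
      _ = _ := by ring
  have hpartial : ∀ N : ℕ, ∃ D : Finset (α × {j : ℤ // j₀ ≤ j} × (Fin n → ℤ)),
      (∀ i ∈ D, (i.2.1 : ℤ) < j₀ + N) ∧
      ‖inner ℂ G (Q (j₀ + N))‖ ≤
        ‖inner ℂ G (Q j₀)‖ + M * ∑ i ∈ D, waveletTerm S.ψ s j₀ μ ν i := by
    intro N
    induction N with
    | zero => exact ⟨∅, by simp, by simp⟩
    | succ N ih =>
      obtain ⟨D, hD, hle⟩ := ih
      set F : Finset (α × (Fin n → ℤ)) :=
        Finset.univ ×ˢ latticeBall n ((2 : ℝ) ^ (j₀ + N : ℤ) * ρ + R)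
      let lvl : {j : ℤ // j₀ ≤ j} := ⟨j₀ + N, by omega⟩
      let emb : α × (Fin n → ℤ) ↪ α × {j : ℤ // j₀ ≤ j} × (Fin n → ℤ) :=
        ⟨fun i => (i.1, lvl, i.2), fun a b hab => by simp at hab; exact Prod.ext hab.1 hab.2⟩
      have hdisj : Disjoint D (F.map emb) := by
        rw [Finset.disjoint_left]
        intro i hi hi'
        obtain ⟨i', -, rfl⟩ := Finset.mem_map.1 hi'
        exact lt_irrefl _ (hD _ hi)
      refine ⟨D ∪ F.map emb, fun i hi => ?_, ?_⟩
      · rcases Finset.mem_union.1 hi with hi | hi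
        · have := hD i hi
          push_cast
          omega
        · obtain ⟨i', -, rfl⟩ := Finset.mem_map.1 hi
          change j₀ + (N : ℤ) < _
          push_cast
          omega
      · have h1 := hstep (j₀ + N) (by omega)
        have h2 : (j₀ + (N + 1 : ℕ) : ℤ) = j₀ + N + 1 := by push_cast; ring
        rw [h2, h1, Finset.sum_union hdisj, mul_add, ← add_assoc]
        refine (norm_add_le _ _).trans (add_le_add hle ?_)
        rw [Finset.sum_map, Finset.mul_sum]
        exact (norm_sum_le _ _).trans (Finset.sum_le_sum fun i _ => hterm (emb i))
  have hbound : ∀ N : ℕ, ‖inner ℂ G (Q (j₀ + N))‖ ≤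
      ‖inner ℂ G (Q j₀)‖ + M * waveletDist S.ψ s j₀ μ ν := fun N => by
    obtain ⟨D, -, hD⟩ := hpartial N
    refine hD.trans ?_
    gcongr
    exact hsum.sum_le_tsum _ fun i _ => waveletTerm_nonneg S.ψ s j₀ μ ν i
  have hlim : Filter.Tendsto (fun N : ℕ => ‖inner ℂ G (Q (j₀ + N))‖) Filter.atTop
      (nhds ‖inner ℂ G P‖) := by
    have h1 : Filter.Tendsto Q Filter.atTop (nhds P) :=
      Submodule.starProjection_tendsto_self S.V S.monotone_V P S.dense_V.ge
    have h2 : Filter.Tendsto (fun N : ℕ => j₀ + (N : ℤ)) Filter.atTop Filter.atTop :=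
      Filter.tendsto_atTop_add_const_left _ _ tendsto_natCast_atTop_atTop
    exact (Filter.Tendsto.inner tendsto_const_nhds (h1.comp h2)).norm
  have hfinal := le_of_tendsto' hlim hbound
  rw [hGP, hbase, Complex.norm_real] at hfinal
  exact (le_abs_self _).trans hfinal

end Lower

section LowLevel

variable {n : ℕ} {α : Type*} [Fintype α] (S : OrthonormalWaveletSystem n α)

/-- The contribution of the levels below `j₀` to the pairing of `μ - ν` with a Hölder function which
vanishes at the origin decays like `2 ^ (j₀ (1 - s))` as `j₀` tends to `-∞`. -/
lemma OrthonormalWaveletSystem.exists_norm_sum_detailCoeff_φ_le (hφ : ContDiff ℝ 1 S.φ)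
    (hφs : HasCompactSupport S.φ) {s : ℝ} (hs0 : 0 < s) {R ρ : ℝ} (hR0 : 0 < R) (hρ0 : 0 ≤ ρ)
    (hRφ : ∀ x, R < ‖x‖ → S.φ x = 0) :
    ∃ C, 0 < C ∧ ∀ (μ ν : Measure (Rn n)) [IsProbabilityMeasure μ] [IsProbabilityMeasure ν],
      μ ≪ volume → ν ≪ volume → (∀ᵐ x ∂μ, ‖x‖ ≤ ρ) → (∀ᵐ x ∂ν, ‖x‖ ≤ ρ) → ∀ j₀ : ℤ, j₀ ≤ 0 →
      ∀ f : Rn n → ℂ, IsHolder s 1 f → f 0 = 0 →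
      ‖∑ k ∈ latticeBall n ((2 : ℝ) ^ j₀ * ρ + R),
        detailCoeff (fun _ : Unit => S.φ) (fun x => ((density μ x - density ν x : ℝ) : ℂ)) () j₀ k *
          ∫ x, f x * dyadic S.φ j₀ k x‖ ≤ C * (2 : ℝ) ^ ((j₀ : ℝ) * (1 - s)) := by
  obtain ⟨L, hL⟩ := hφ.lipschitzWith_of_hasCompactSupport hφs (by simp)
  have hI : 0 ≤ ∫ x, ‖S.φ x‖ := integral_nonneg fun _ => norm_nonneg _
  have hRρ : 0 ≤ R + (ρ + R) := by positivity
  set C : ℝ := (latticeBall n (ρ + R)).card *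
    (2 * (L * ρ) * ((R + (ρ + R)) ^ s * ∫ x, ‖S.φ x‖)) with hC
  have hC0 : 0 ≤ C := by positivity
  refine ⟨C + 1, by positivity, fun μ ν _ _ hμ hν hμρ hνρ j₀ hj₀ f hf hf0 => ?_⟩
  have h2j : (2 : ℝ) ^ j₀ ≤ 1 := zpow_le_one_of_nonpos₀ one_le_two hj₀
  have hsub : latticeBall n ((2 : ℝ) ^ j₀ * ρ + R) ⊆ latticeBall n (ρ + R) := fun k hk => by
    rw [mem_latticeBall] at hk ⊢
    have : (2 : ℝ) ^ j₀ * ρ ≤ 1 * ρ := by gcongr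
    linarith
  have hterm : ∀ k ∈ latticeBall n ((2 : ℝ) ^ j₀ * ρ + R),
      ‖detailCoeff (fun _ : Unit => S.φ) (fun x => ((density μ x - density ν x : ℝ) : ℂ)) () j₀ k *
        ∫ x, f x * dyadic S.φ j₀ k x‖ ≤
      2 * (L * ρ) * ((R + (ρ + R)) ^ s * ∫ x, ‖S.φ x‖) * (2 : ℝ) ^ ((j₀ : ℝ) * (1 - s)) := by
    intro k hk
    have h1 := norm_detailCoeff_le (ψ := fun _ : Unit => S.φ) (fun _ => hφ.continuous)
      (fun _ => hφs) hμ hν hμρ hνρ () hL j₀ k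
    have h2 := norm_integral_mul_dyadic_le_of_zero hs0 hf hf0 S.integrable_φ hRφ j₀
      (mem_latticeBall.1 (hsub hk))
    rw [norm_mul]
    refine (mul_le_mul h1 h2 (norm_nonneg _) (by positivity)).trans_eq ?_
    have e1 : (2 : ℝ) ^ ((n : ℝ) * (j₀ : ℝ) / 2) * (2 : ℝ) ^ (-((n : ℝ) * (j₀ : ℝ) / 2)) = 1 := by
      rw [← Real.rpow_add two_pos, add_neg_cancel, Real.rpow_zero]
    have e2 : (2 : ℝ) ^ ((j₀ : ℝ) * (1 - s)) = (2 : ℝ) ^ j₀ * (2 : ℝ) ^ (-(j₀ : ℝ) * s) := by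
      rw [← Real.rpow_intCast, ← Real.rpow_add two_pos]; ring_nf
    rw [e2]
    linear_combination (2 * (L * ρ) * (2 : ℝ) ^ j₀ * (2 : ℝ) ^ (-(j₀ : ℝ) * s) *
      ((R + (ρ + R)) ^ s * ∫ x, ‖S.φ x‖)) * e1
  calc _ ≤ ∑ k ∈ latticeBall n ((2 : ℝ) ^ j₀ * ρ + R),
        2 * (L * ρ) * ((R + (ρ + R)) ^ s * ∫ x, ‖S.φ x‖) * (2 : ℝ) ^ ((j₀ : ℝ) * (1 - s)) :=
        (norm_sum_le _ _).trans (Finset.sum_le_sum hterm)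
    _ ≤ ∑ k ∈ latticeBall n (ρ + R),
        2 * (L * ρ) * ((R + (ρ + R)) ^ s * ∫ x, ‖S.φ x‖) * (2 : ℝ) ^ ((j₀ : ℝ) * (1 - s)) :=
        Finset.sum_le_sum_of_subset_of_nonneg hsub fun _ _ _ => by positivity
    _ = C * (2 : ℝ) ^ ((j₀ : ℝ) * (1 - s)) := by
        rw [Finset.sum_const, nsmul_eq_mul, hC]; ring
    _ ≤ _ := by gcongr; linarith

/-- The lower bound for the wavelet distance, with an error which decays with the lowest level. -/
theorem OrthonormalWaveletSystem.exists_wassersteinDist_le (hφ : ContDiff ℝ 1 S.φ)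
    (hφs : HasCompactSupport S.φ) (hψc : ∀ ε, Continuous (S.ψ ε))
    (hψs : ∀ ε, HasCompactSupport (S.ψ ε)) {s : ℝ} (hs0 : 0 < s) (hs1 : s ≤ 1) {K : Set (Rn n)}
    (hK : IsCompact K) :
    ∃ C, 0 < C ∧ ∀ j₀ : ℤ, j₀ ≤ 0 → ∀ μ ν : Measure (Rn n), IsAb2On K μ → IsAb2On K ν →
      Summable (waveletTerm S.ψ s j₀ μ ν) →
      wassersteinDist s μ ν ≤ C * (2 : ℝ) ^ ((j₀ : ℝ) * (1 - s)) +
        (⨆ ε, holderDualNorm s (S.ψ ε)) * waveletDist S.ψ s j₀ μ ν := by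
  obtain ⟨R₁, hR₁0, hR₁⟩ := exists_radius_of_hasCompactSupport hφs
  obtain ⟨R₂, -, hR₂⟩ := exists_common_radius hψs
  obtain ⟨ρ, hρ⟩ := hK.isBounded.exists_norm_le
  have hR0 : 0 < max R₁ R₂ := lt_max_of_lt_left hR₁0
  have hRφ : ∀ x, max R₁ R₂ < ‖x‖ → S.φ x = 0 := fun x hx => hR₁ x ((le_max_left _ _).trans_lt hx)
  obtain ⟨C, hC0, hC⟩ := S.exists_norm_sum_detailCoeff_φ_le hφ hφs hs0 hR0 (le_max_right ρ 0) hRφ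
  refine ⟨C, hC0, fun j₀ hj₀ μ ν hμ hν hsum => ?_⟩
  have := hμ.isProbabilityMeasure
  have := hν.isProbabilityMeasure
  have hbd : ∀ τ : Measure (Rn n), τ Kᶜ = 0 → ∀ᵐ x ∂τ, ‖x‖ ≤ max ρ 0 := fun τ hτ => by
    have h : ∀ᵐ x ∂τ, x ∈ K := mem_ae_iff.2 hτ
    exact h.mono fun x hx => (hρ x hx).trans (le_max_left _ _)
  refine wassersteinDist_le_of_forall_holder hK hs0 hs1 hμ.measure_compl hν.measure_compl _
    fun f hf => ?_
  -- Subtracting `f 0` does not change the difference of the integrals.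
  have hfH : IsHolder s 1 fun x => (f x : ℂ) := fun x y => by
    rw [one_mul, ← Complex.ofReal_sub, Complex.norm_real]
    exact hf x y
  have hfc : Continuous f := by
    have := Complex.continuous_re.comp (hfH.continuous hs0)
    exact this
  have hfi : ∀ τ : Measure (Rn n), IsProbabilityMeasure τ → τ Kᶜ = 0 → Integrable f τ :=
      fun τ _ hτ => by
    have h := hfc.continuousOn.integrableOn_compact (μ := τ) hK
    rwa [IntegrableOn, Measure.restrict_eq_self_of_ae_mem (mem_ae_iff.2 hτ)] at h
  have hshift : ∫ x, f x ∂μ - ∫ x, f x ∂ν = ∫ x, (f x - f 0) ∂μ - ∫ x, (f x - f 0) ∂ν := by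
    rw [integral_sub (hfi μ inferInstance hμ.measure_compl) (integrable_const _),
      integral_sub (hfi ν inferInstance hν.measure_compl) (integrable_const _)]
    simp
  have hf0 : ∀ x y, |(f x - f 0) - (f y - f 0)| ≤ ‖x - y‖ ^ s := fun x y => by
    rw [sub_sub_sub_cancel_right]
    exact hf x y
  have hf0H : IsHolder s 1 fun x => ((f x - f 0 : ℝ) : ℂ) := fun x y => by
    rw [one_mul, ← Complex.ofReal_sub, Complex.norm_real]
    exact hf0 x y
  rw [hshift]
  refine (S.integral_sub_integral_le hφ.continuous hφs hψc hψs hs0 hR0 hRφ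
    (fun ε x hx => hR₂ ε x ((le_max_right _ _).trans_lt hx)) hμ.absolutelyContinuous
    hν.absolutelyContinuous hμ.memLp_density hν.memLp_density (hbd μ hμ.measure_compl)
    (hbd ν hν.measure_compl) hsum hf0).trans ?_
  gcongr
  exact hC μ ν hμ.absolutelyContinuous hν.absolutelyContinuous (hbd μ hμ.measure_compl)
    (hbd ν hν.measure_compl) j₀ hj₀ _ hf0H (by simp)

end LowLevel

end WaveletWasserstein

end

theorem theorem3p13 {n : ℕ} {α : Type*} [Fintype α]
    (S : WaveletWasserstein.OrthonormalWaveletSystem n α)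
    (r : ℕ) (hr : 1 ≤ r) (hreg : S.IsRegular r) (hsupp : S.IsCompactlySupported)
    (s : ℝ) (hs0 : 0 < s) (hs1 : s < 1)
    (K : Set (WaveletWasserstein.Rn n)) (hK : IsCompact K)
    (η : ℝ) (hη : 0 < η) :
    ∃ J : ℤ, ∀ j₀ : ℤ, j₀ ≤ J →
      ∀ μ ν : Measure (WaveletWasserstein.Rn n),
        WaveletWasserstein.IsAb2On K μ → WaveletWasserstein.IsAb2On K ν →
        Summable (WaveletWasserstein.waveletTerm S.ψ s j₀ μ ν) ∧
        WaveletWasserstein.a14 S.ψ s * WaveletWasserstein.wassersteinDist s μ ν - η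
          ≤ WaveletWasserstein.waveletDist S.ψ s j₀ μ ν ∧
        WaveletWasserstein.waveletDist S.ψ s j₀ μ ν
          ≤ WaveletWasserstein.upperConst S.ψ s j₀ * WaveletWasserstein.wassersteinDist s μ ν := by
  have hr' : (1 : WithTop ℕ∞) ≤ r := by exact_mod_cast hr
  have hφ : ContDiff ℝ 1 S.φ := hreg.1.1.of_le hr'
  have hψ : ∀ ε, ContDiff ℝ 1 (S.ψ ε) := fun ε => (hreg.2 ε).1.of_le hr'
  obtain ⟨C, hC0, hC⟩ :=
    WaveletWasserstein.exists_sum_waveletTerm_le hψ hsupp.2 hs0 hs1 hK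
  obtain ⟨C', hC'0, hC'⟩ := S.exists_wassersteinDist_le hφ hsupp.1 (fun ε => (hψ ε).continuous)
    hsupp.2 hs0 hs1.le hK
  obtain ⟨J₁, hJ₁⟩ : ∃ J : ℤ, ∀ j₀ ≤ J, ∀ μ ν : Measure (WaveletWasserstein.Rn n),
      WaveletWasserstein.IsAb2On K μ → WaveletWasserstein.IsAb2On K ν →
      WaveletWasserstein.waveletDist S.ψ s j₀ μ ν
        ≤ WaveletWasserstein.upperConst S.ψ s j₀ * WaveletWasserstein.wassersteinDist s μ ν := by
    rcases isEmpty_or_nonempty α with hα | hα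
    · refine ⟨0, fun j₀ _ μ ν _ _ => ?_⟩
      rw [WaveletWasserstein.waveletDist, tsum_empty]
      exact mul_nonneg (WaveletWasserstein.upperConst_nonneg S.ψ hs0 hs1 j₀) ENNReal.toReal_nonneg
    · obtain ⟨J, hJ⟩ := S.exists_le_upperConst hψ hsupp.2 hs0 hs1 C
      refine ⟨J, fun j₀ hj₀ μ ν hμ hν => ?_⟩
      have h0 : 0 ≤ WaveletWasserstein.wassersteinDist s μ ν := ENNReal.toReal_nonneg
      refine (Real.tsum_le_of_sum_le (WaveletWasserstein.waveletTerm_nonneg S.ψ s j₀ μ ν)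
        (hC j₀ μ ν hμ hν)).trans ?_
      gcongr
      exact hJ j₀ hj₀
  set M : ℝ := ⨆ ε, WaveletWasserstein.holderDualNorm s (S.ψ ε) with hM
  have hM0 : 0 ≤ M := WaveletWasserstein.iSup_holderDualNorm_nonneg S.ψ s
  -- The error of the lower bound is below `η * M` for all sufficiently low levels.
  obtain ⟨N, hN⟩ := pow_unbounded_of_one_lt (C' / (η * M))
    (Real.one_lt_rpow one_lt_two (by linarith : 0 < 1 - s))
  refine ⟨min J₁ (-N), fun j₀ hj₀ μ ν hμ hν => ?_⟩
  have hsum : Summable (WaveletWasserstein.waveletTerm S.ψ s j₀ μ ν) :=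
    summable_of_sum_le (WaveletWasserstein.waveletTerm_nonneg S.ψ s j₀ μ ν) (hC j₀ μ ν hμ hν)
  have hjN : j₀ ≤ -N := hj₀.trans (min_le_right _ _)
  refine ⟨hsum, ?_, hJ₁ j₀ (hj₀.trans (min_le_left _ _)) μ ν hμ hν⟩
  have hwav : 0 ≤ WaveletWasserstein.waveletDist S.ψ s j₀ μ ν :=
    tsum_nonneg (WaveletWasserstein.waveletTerm_nonneg S.ψ s j₀ μ ν)
  rw [WaveletWasserstein.a14, ← hM]
  rcases hM0.eq_or_lt with h0 | hMpos
  · rw [← h0, div_zero, zero_mul]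
    linarith
  · have h1 := hC' j₀ (by omega) μ ν hμ hν hsum
    have h2 : C' * (2 : ℝ) ^ ((j₀ : ℝ) * (1 - s)) ≤ η * M := by
      have h3 : (2 : ℝ) ^ ((j₀ : ℝ) * (1 - s)) ≤ (((2 : ℝ) ^ (1 - s)) ^ N)⁻¹ := by
        rw [← Real.rpow_mul_natCast two_pos.le, ← Real.rpow_neg two_pos.le]
        refine Real.rpow_le_rpow_of_exponent_le one_le_two ?_
        have h4 : (j₀ : ℝ) ≤ -N := by exact_mod_cast hjN
        nlinarith
      rw [div_lt_iff₀ (by positivity)] at hN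
      calc _ ≤ C' * (((2 : ℝ) ^ (1 - s)) ^ N)⁻¹ := by gcongr
        _ ≤ η * M := by
          rw [← div_eq_mul_inv, div_le_iff₀ (by positivity)]
          linarith
    rw [sub_le_iff_le_add, one_div, inv_mul_le_iff₀ hMpos]
    linarith
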